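/- Let $\mathbb{K}$ be a field of characteristic zero and $J$ a unital Jordan algebra over $\mathbb{K}$ (of arbitrary dimension). For $a,b\in J$ put $\partial_{a,b}(x)=a(bx)-(ax)b$, and let $\{J,J\}=(\bigwedge^2J)/\mathrm{Span}\{a\wedge a^2\mid a\in J\}$, with $\{a,b\}$ the class of $a\wedge b$. Let $e,h,f$ be the standard basis of $\mathfrak{sl}_2=\mathfrak{sl}_2(\mathbb{K})$ and $\kappa$ the invariant form on $\mathfrak{sl}_2$ with $\kappa(h,h)=4$. Let $\mathfrak{G}=\widehat{\mathfrak{sl}}_2(J)$ be the Lie algebra $(\mathfrak{sl}_2\otimes J)\oplus\{J,J\}$ with bracket (writing $x(a)=x\otimes a$) $$[x(a),y(b)]=[x,y](ab)+\kappa(x,y)\{a,b\},\quad [\{a,b\},x(c)]=x(\partial_{a,b}c),\quad [\{a,b\},\{c,d\}]=\{\partial_{a,b}c,d\}+\{c,\partial_{a,b}d\},$$ and let $\mathfrak{G}_2=e\otimes J$. A $(\mathfrak{G},\mathrm{SL}_2)$-module is a $\mathfrak{G}$-module that is locally finite dimensional under $\mathfrak{sl}_2=\mathfrak{sl}_2\otimes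 1$; for such a module $X$, $H^0(\mathfrak{G}_2,X)$ denotes the subspace of vectors killed by $\mathfrak{G}_2$. A $J$-space is a $\mathbb{K}$-vector space $V$ with a linear map $\rho:J\to\mathrm{End}_{\mathbb{K}}(V)$ such that $[\rho(a),\rho(a^2)]=0$ and $[[\rho(a),\rho(b)],\rho(c)]=4\rho(\partial_{a,b}c)$ for all $a,b,c\in J$. For every $(\mathfrak{G},\mathrm{SL}_2)$-module $X$, $H^0(\mathfrak{G}_2,X)$ is a $J$-space, $a\in J$ acting by $h(a)$. A $J$-space is called dominant if it is isomorphic to a $J$-subspace of $H^0(\mathfrak{G}_2,X)$ for some $(\mathfrak{G},\mathrm{SL}_2)$-module $X$. **Theorem.** Let $n\ge 0$ be an integer and let $(V,\rho)$ be a $J$-space of level $n$, i.e. $\rho(1)=n\,\mathrm{id}_V$. Then $(V,\rho)$ is dominant if and only if $$\sum_{\sigma\vdash n+1}\mathrm{sgn}(\sigma)\,|C_\sigma|\,\rho_\sigma(a)=0\qquad\text{for all }a\in J,$$ where, for a partition $\sigma=(\sigma_1\ge\cdots\ge\sigma_m\ge 1)$ of $n+1$, $C_\sigma\subset S_{n+1}$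 is the conjugacy class of the permutations with cycle lengths $\sigma_1,\dots,\sigma_m$, $\mathrm{sgn}(\sigma)$ is the sign of its elements, and $\rho_\sigma(a)=\rho(a^{\sigma_1})\rho(a^{\sigma_2})\cdots\rho(a^{\sigma_m})$. -/

import Mathlib

open scoped TensorProduct

namespace TitsAllisonGao

universe u v w

set_option linter.unusedSectionVars false
set_option linter.unusedSimpArgs false

theorem jordan_linearized (K : Type u) {J : Type v} [Field K] [CharZero K] [NonAssocCommRing J]
    [IsCommJordan J] [Module K J] (a b c d : J) :
    a * ((b * c) * d) - (b * c) * (a * d) + (b * ((c * a) * d) - (c * a) * (b * d))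
      + (c * ((a * b) * d) - (a * b) * (c * d)) = 0 := by
  have h := DFunLike.congr_fun (two_nsmul_lie_lmul_lmul_add_add_eq_zero a b c) d
  have h' : (2 : K) • (a * ((b * c) * d) - (b * c) * (a * d)
      + (b * ((c * a) * d) - (c * a) * (b * d))
      + (c * ((a * b) * d) - (a * b) * (c * d))) = 0 := by
    rw [two_smul, ← two_nsmul]
    exact h
  exact (smul_eq_zero.1 h').resolve_left two_ne_zero

section Jordan

variable (K : Type u) {J : Type v} [Field K] [NonAssocCommRing J] [Module K J]
  [IsScalarTower K J J] [SMulCommClass K J J]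

/-- The linear map `∂_{a,b} : x ↦ a (b x) - (a x) b` of a Jordan algebra. -/
def innerDer (a b : J) : J →ₗ[K] J :=
  LinearMap.mulLeft K a ∘ₗ LinearMap.mulLeft K b - LinearMap.mulRight K b ∘ₗ LinearMap.mulLeft K a

theorem innerDer_apply (a b x : J) : innerDer K a b x = a * (b * x) - (a * x) * b := rfl

/-- `(a, b) ↦ ∂_{a,b}` as a bilinear map. -/
def innerDerBilin : J →ₗ[K] J →ₗ[K] (J →ₗ[K] J) :=
  LinearMap.mk₂ K (innerDer K)
    (fun a a' b => by ext x; simp only [innerDer_apply, LinearMap.add_apply, add_mul]; abel)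
    (fun c a b => by
      ext x; simp only [innerDer_apply, LinearMap.smul_apply, smul_mul_assoc, smul_sub])
    (fun a b b' => by
      ext x; simp only [innerDer_apply, LinearMap.add_apply, add_mul, mul_add]; abel)
    (fun c a b => by
      ext x
      simp only [innerDer_apply, LinearMap.smul_apply, smul_mul_assoc, mul_smul_comm, smul_sub])

variable (J) in
/-- The relations `a ⊗ a` (which cut `⋀² J` out of `J ⊗ J`) and `a ⊗ a²`. -/
def curlyRel : Submodule K (J ⊗[K] J) :=
  Submodule.span K
    (Set.range (fun a : J => a ⊗ₜ[K] a) ∪ Set.range (fun a : J => a ⊗ₜ[K] (a * a)))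

variable (J) in
/-- `{J,J} = (⋀² J) / span {a ∧ a²}`, with `⋀² J` written as `(J ⊗ J) / span {a ⊗ a}`. -/
abbrev Curly : Type v := (J ⊗[K] J) ⧸ curlyRel K J

/-- The bracket symbol `{a,b}`, the class of `a ∧ b`. -/
def curly (a b : J) : Curly K J := (curlyRel K J).mkQ (a ⊗ₜ[K] b)

theorem curly_add_left (a a' b : J) : curly K (a + a') b = curly K a b + curly K a' b := by
  simp only [curly, TensorProduct.add_tmul, map_add]

theorem curly_add_right (a b b' : J) : curly K a (b + b') = curly K a b + curly K a b' := by
  simp only [curly, TensorProduct.tmul_add, map_add]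

theorem curly_smul_left (c : K) (a b : J) : curly K (c • a) b = c • curly K a b := by
  simp only [curly, ← TensorProduct.smul_tmul', map_smul]

theorem curly_smul_right (c : K) (a b : J) : curly K a (c • b) = c • curly K a b := by
  simp only [curly, TensorProduct.tmul_smul, map_smul]

theorem curly_self (a : J) : curly K a a = 0 :=
  (Submodule.Quotient.mk_eq_zero _).2 (Submodule.subset_span (Or.inl ⟨a, rfl⟩))

theorem curly_sq (a : J) : curly K a (a * a) = 0 :=
  (Submodule.Quotient.mk_eq_zero _).2 (Submodule.subset_span (Or.inr ⟨a, rfl⟩))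

/-- `(a, b) ↦ {a,b}` as a bilinear map. -/
def curlyBilin : J →ₗ[K] J →ₗ[K] Curly K J :=
  LinearMap.mk₂ K (curly K) (curly_add_left K) (curly_smul_left K) (curly_add_right K)
    (curly_smul_right K)

theorem curlyBilin_apply (a b : J) : curlyBilin K a b = curly K a b := rfl

theorem curly_neg_left (a b : J) : curly K (-a) b = -curly K a b := by
  simp only [← curlyBilin_apply, map_neg, LinearMap.neg_apply]

theorem curly_neg_right (a b : J) : curly K a (-b) = -curly K a b := by
  simp only [← curlyBilin_apply, map_neg]

theorem curly_sub_left (a a' b : J) : curly K (a - a') b = curly K a b - curly K a' b := by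
  simp only [← curlyBilin_apply, map_sub, LinearMap.sub_apply]

theorem curly_sub_right (a b b' : J) : curly K a (b - b') = curly K a b - curly K a b' := by
  simp only [← curlyBilin_apply, map_sub]

theorem curly_zero_left (b : J) : curly K 0 b = 0 := by
  simp only [← curlyBilin_apply, map_zero, LinearMap.zero_apply]

theorem curly_zero_right (a : J) : curly K a 0 = 0 := by
  simp only [← curlyBilin_apply, map_zero]

theorem curly_skew (a b : J) : curly K a b = -curly K b a := by
  have h := curly_self K (a + b)
  rw [curly_add_left, curly_add_right, curly_add_right, curly_self, curly_self, zero_add,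
    add_zero] at h
  rw [add_comm] at h
  exact eq_neg_of_add_eq_zero_right h

theorem curly_induction {P : Curly K J → Prop} (h0 : P 0) (h1 : ∀ a b, P (curly K a b))
    (h2 : ∀ p q, P p → P q → P (p + q)) (p : Curly K J) : P p := by
  obtain ⟨t, rfl⟩ := Submodule.mkQ_surjective _ p
  induction t using TensorProduct.induction_on with
  | zero => simpa using h0
  | tmul a b => exact h1 a b
  | add s t hs ht => rw [map_add]; exact h2 _ _ hs ht

theorem curly_hom_ext {N : Type w} [AddCommGroup N] [Module K N] {f g : Curly K J →ₗ[K] N}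
    (h : ∀ a b, f (curly K a b) = g (curly K a b)) : f = g := by
  refine LinearMap.ext fun p => ?_
  induction p using curly_induction with
  | h0 => simp only [map_zero]
  | h1 a b => exact h a b
  | h2 p q hp hq => simp only [map_add, hp, hq]

/-- A bilinear map `B` on `J` with `B a a = 0` and `B a a² = 0` induces a linear map
`{a,b} ↦ B a b` on `{J,J}`. -/
def curlyLift {N : Type w} [AddCommGroup N] [Module K N] (B : J →ₗ[K] J →ₗ[K] N)
    (h1 : ∀ a, B a a = 0) (h2 : ∀ a, B a (a * a) = 0) : Curly K J →ₗ[K] N :=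
  (curlyRel K J).liftQ (TensorProduct.lift B) (by
    rw [curlyRel, Submodule.span_le]
    rintro _ (⟨a, rfl⟩ | ⟨a, rfl⟩)
    · simpa using h1 a
    · simpa using h2 a)

theorem curlyLift_curly {N : Type w} [AddCommGroup N] [Module K N] (B : J →ₗ[K] J →ₗ[K] N)
    (h1 : ∀ a, B a a = 0) (h2 : ∀ a, B a (a * a) = 0) (a b : J) :
    curlyLift K B h1 h2 (curly K a b) = B a b := by
  simp [curlyLift, curly]

variable [CharZero K]

/-- The linearized relation `{ab,c} + {bc,a} + {ca,b} = 0`. -/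
theorem curly_cyclic (a b c : J) :
    curly K (a * b) c + curly K (b * c) a + curly K (c * a) b = 0 := by
  have key : ∀ x y : J, curly K x (y * y) + (2 : K) • curly K y (x * y) = 0 := by
    intro x y
    have h1 := curly_sq K (x + y)
    have h2 := curly_sq K (x - y)
    simp only [curly_add_left, curly_add_right, curly_sub_left, curly_sub_right, mul_add, add_mul,
      mul_sub, sub_mul, curly_sq, mul_comm y x] at h1 h2
    linear_combination (norm := module) (2⁻¹ : K) • h1 + (2⁻¹ : K) • h2
  have h1 := key a (b + c)
  have h2 := key a b
  have h3 := key a c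
  simp only [curly_add_left, curly_add_right, mul_add, add_mul, mul_comm c b] at h1
  rw [curly_skew K (a * b), curly_skew K (b * c), curly_skew K (c * a), mul_comm c a]
  linear_combination (norm := module)
    (-2⁻¹ : K) • h1 + (2⁻¹ : K) • h2 + (2⁻¹ : K) • h3

variable [IsCommJordan J]

theorem innerDer_self (a : J) : innerDer K a a = 0 := by
  ext x
  rw [innerDer_apply, mul_comm (a * x) a, sub_self, LinearMap.zero_apply]

theorem innerDer_sq (a : J) : innerDer K a (a * a) = 0 := by
  ext x
  rw [innerDer_apply, mul_comm (a * a) x, IsCommJordan.lmul_comm_rmul_rmul, sub_self,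
    LinearMap.zero_apply]

/-- `∂_{a,b}` is a derivation. -/
theorem innerDer_mul (a b c d : J) :
    innerDer K a b (c * d) = innerDer K a b c * d + c * innerDer K a b d := by
  have h1 := jordan_linearized K b c d a
  have h2 := jordan_linearized K a c d b
  simp only [innerDer_apply, sub_mul, mul_sub]
  simp only [mul_comm] at h1 h2 ⊢
  linear_combination (norm := module) (1 : K) • h2 - (1 : K) • h1

/-- The linear map `{J,J} → Inn J`, `{a,b} ↦ ∂_{a,b}`. -/
def curlyDer : Curly K J →ₗ[K] (J →ₗ[K] J) :=
  curlyLift K (innerDerBilin K) (innerDer_self K) (innerDer_sq K)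

theorem curlyDer_curly (a b : J) : curlyDer K (curly K a b) = innerDer K a b :=
  curlyLift_curly K _ _ _ a b

theorem curlyDer_curly_apply (a b x : J) :
    curlyDer K (curly K a b) x = a * (b * x) - (a * x) * b := by
  rw [curlyDer_curly, innerDer_apply]

theorem curlyDer_mul (p : Curly K J) (c d : J) :
    curlyDer K p (c * d) = curlyDer K p c * d + c * curlyDer K p d := by
  induction p using curly_induction with
  | h0 => simp only [map_zero, LinearMap.zero_apply, zero_mul, mul_zero, add_zero]
  | h1 a b => rw [curlyDer_curly, innerDer_mul]
  | h2 p q hp hq =>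
    simp only [map_add, LinearMap.add_apply, hp, hq, add_mul, mul_add]
    abel

/-- The action of `p ∈ {J,J}` on `{J,J}`: `{c,d} ↦ {∂ c, d} + {c, ∂ d}`, where `∂` is the inner
derivation attached to `p`. -/
def curlyActAux (p : Curly K J) : Curly K J →ₗ[K] Curly K J :=
  curlyLift K ((curlyBilin K).comp (curlyDer K p) + (curlyBilin K).compl₂ (curlyDer K p))
    (fun a => by
      simp only [LinearMap.add_apply, LinearMap.comp_apply, LinearMap.compl₂_apply,
        curlyBilin_apply]
      rw [curly_skew, neg_add_cancel])
    (fun a => by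
      simp only [LinearMap.add_apply, LinearMap.comp_apply, LinearMap.compl₂_apply,
        curlyBilin_apply]
      have h := curly_cyclic K (curlyDer K p a) a a
      rw [curly_skew K (a * a)] at h
      rw [curlyDer_mul, curly_add_right, mul_comm a (curlyDer K p a),
        curly_skew K a (curlyDer K p a * a)]
      rw [mul_comm a (curlyDer K p a)] at h
      linear_combination (norm := module) (-1 : K) • h)

theorem curlyActAux_curly (p : Curly K J) (c d : J) :
    curlyActAux K p (curly K c d) =
      curly K (curlyDer K p c) d + curly K c (curlyDer K p d) :=
  curlyLift_curly K _ _ _ c d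

/-- The action of `{J,J}` on itself as a bilinear map. -/
def curlyAct : Curly K J →ₗ[K] Curly K J →ₗ[K] Curly K J where
  toFun := curlyActAux K
  map_add' p q := curly_hom_ext K fun a b => by
    simp only [curlyActAux_curly, map_add, LinearMap.add_apply, curly_add_left, curly_add_right]
    abel
  map_smul' c p := curly_hom_ext K fun a b => by
    simp only [curlyActAux_curly, map_smul, LinearMap.smul_apply, curly_smul_left,
      curly_smul_right, smul_add, RingHom.id_apply]

theorem curlyAct_curly (p : Curly K J) (c d : J) :
    curlyAct K p (curly K c d) =
      curly K (curlyDer K p c) d + curly K c (curlyDer K p d) :=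
  curlyActAux_curly K p c d

theorem curlyAct_skew (p q : Curly K J) : curlyAct K p q = -curlyAct K q p := by
  induction p using curly_induction with
  | h0 => simp only [map_zero, LinearMap.zero_apply, neg_zero]
  | h2 p p' hp hp' => simp only [map_add, LinearMap.add_apply, hp, hp', neg_add]
  | h1 a b =>
    induction q using curly_induction with
    | h0 => simp only [map_zero, LinearMap.zero_apply, neg_zero]
    | h2 q q' hq hq' => simp only [map_add, LinearMap.add_apply, hq, hq', neg_add]
    | h1 c d =>
      have h1 := curly_cyclic K a (b * c) d
      have h2 := curly_cyclic K b (a * c) d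
      have h3 := curly_cyclic K a (b * d) c
      have h4 := curly_cyclic K b (a * d) c
      simp only [curlyAct_curly, curlyDer_curly_apply, curly_sub_left, curly_sub_right]
      have s1 := curly_skew K (d * a) (b * c)
      have s2 := curly_skew K (d * b) (a * c)
      rw [curly_skew K c (a * (b * d)), curly_skew K c (a * d * b), curly_skew K a (c * (d * b)),
        curly_skew K a (c * b * d)]
      simp only [mul_comm] at h1 h2 h3 h4 s1 s2 ⊢
      linear_combination (norm := module) (1 : K) • h1 - (1 : K) • h2 - (1 : K) • h3
        + (1 : K) • h4 - (1 : K) • s1 + (1 : K) • s2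

theorem curlyDer_act (p q : Curly K J) (x : J) :
    curlyDer K (curlyAct K p q) x =
      curlyDer K p (curlyDer K q x) - curlyDer K q (curlyDer K p x) := by
  induction q using curly_induction with
  | h0 => simp only [map_zero, LinearMap.zero_apply, sub_zero]
  | h2 q q' hq hq' =>
    simp only [map_add, LinearMap.add_apply, hq, hq']
    abel
  | h1 a b =>
    simp only [curlyAct_curly, map_add, LinearMap.add_apply, curlyDer_curly_apply, curlyDer_mul,
      map_sub, mul_add, add_mul]
    abel

theorem curlyAct_act (p q r : Curly K J) :
    curlyAct K (curlyAct K p q) r =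
      curlyAct K p (curlyAct K q r) - curlyAct K q (curlyAct K p r) := by
  induction r using curly_induction with
  | h0 => simp only [map_zero, sub_zero]
  | h2 r r' hr hr' =>
    simp only [map_add, hr, hr']
    abel
  | h1 a b =>
    simp only [curlyAct_curly, map_add, curlyDer_act, curly_sub_left, curly_sub_right]
    abel

end Jordan

section LieAlgebra

/-- The Lie algebra `𝔰𝔩₂^(J) = (𝔰𝔩₂ ⊗ J) ⊕ {J,J}`. The element `⟨a, b, c, p⟩` stands for
`e(a) + h(b) + f(c) + p`, where `x(a) = x ⊗ a` and `e, h, f` is the standard basis of `𝔰𝔩₂`. -/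
@[ext]
structure SlHat (K : Type u) (J : Type v) [Field K] [NonAssocCommRing J] [Module K J] :
    Type v where
  /-- The coefficient of `e`. -/
  ePart : J
  /-- The coefficient of `h`. -/
  hPart : J
  /-- The coefficient of `f`. -/
  fPart : J
  /-- The component in `{J,J}`. -/
  cPart : Curly K J

namespace SlHat

variable {K : Type u} {J : Type v} [Field K] [NonAssocCommRing J] [Module K J]

/-- The components of an element, as an equivalence with a product. -/
def equivProd : SlHat K J ≃ J × J × J × Curly K J where
  toFun x := (x.ePart, x.hPart, x.fPart, x.cPart)
  invFun y := ⟨y.1, y.2.1, y.2.2.1, y.2.2.2⟩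

instance : AddCommGroup (SlHat K J) := equivProd.addCommGroup

instance : Module K (SlHat K J) := equivProd.module K

@[simp] theorem zero_ePart : (0 : SlHat K J).ePart = 0 := rfl
@[simp] theorem zero_hPart : (0 : SlHat K J).hPart = 0 := rfl
@[simp] theorem zero_fPart : (0 : SlHat K J).fPart = 0 := rfl
@[simp] theorem zero_cPart : (0 : SlHat K J).cPart = 0 := rfl
@[simp] theorem add_ePart (x y : SlHat K J) : (x + y).ePart = x.ePart + y.ePart := rfl
@[simp] theorem add_hPart (x y : SlHat K J) : (x + y).hPart = x.hPart + y.hPart := rfl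
@[simp] theorem add_fPart (x y : SlHat K J) : (x + y).fPart = x.fPart + y.fPart := rfl
@[simp] theorem add_cPart (x y : SlHat K J) : (x + y).cPart = x.cPart + y.cPart := rfl
@[simp] theorem neg_ePart (x : SlHat K J) : (-x).ePart = -x.ePart := rfl
@[simp] theorem neg_hPart (x : SlHat K J) : (-x).hPart = -x.hPart := rfl
@[simp] theorem neg_fPart (x : SlHat K J) : (-x).fPart = -x.fPart := rfl
@[simp] theorem neg_cPart (x : SlHat K J) : (-x).cPart = -x.cPart := rfl
@[simp] theorem smul_ePart (t : K) (x : SlHat K J) : (t • x).ePart = t • x.ePart := rfl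
@[simp] theorem smul_hPart (t : K) (x : SlHat K J) : (t • x).hPart = t • x.hPart := rfl
@[simp] theorem smul_fPart (t : K) (x : SlHat K J) : (t • x).fPart = t • x.fPart := rfl
@[simp] theorem smul_cPart (t : K) (x : SlHat K J) : (t • x).cPart = t • x.cPart := rfl

variable (K)

/-- `e(a) = e ⊗ a`, linear in `a`. -/
def e : J →ₗ[K] SlHat K J where
  toFun a := ⟨a, 0, 0, 0⟩
  map_add' a b := by ext <;> simp
  map_smul' t a := by ext <;> simp

/-- `h(a) = h ⊗ a`, linear in `a`. -/
def h : J →ₗ[K] SlHat K J where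
  toFun a := ⟨0, a, 0, 0⟩
  map_add' a b := by ext <;> simp
  map_smul' t a := by ext <;> simp

/-- `f(a) = f ⊗ a`, linear in `a`. -/
def f : J →ₗ[K] SlHat K J where
  toFun a := ⟨0, 0, a, 0⟩
  map_add' a b := by ext <;> simp
  map_smul' t a := by ext <;> simp

variable (J) in
/-- The inclusion of `{J,J}`. -/
def c : Curly K J →ₗ[K] SlHat K J where
  toFun p := ⟨0, 0, 0, p⟩
  map_add' a b := by ext <;> simp
  map_smul' t a := by ext <;> simp

variable {K}

variable [CharZero K] [IsScalarTower K J J] [SMulCommClass K J J] [IsCommJordan J]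

/-- The bracket of `𝔰𝔩₂^(J)`: the bilinear extension of
`[x(a), y(b)] = [x,y](ab) + κ(x,y) {a,b}`, `[{a,b}, x(c)] = x(∂_{a,b} c)` and
`[{a,b}, {c,d}] = {∂_{a,b} c, d} + {c, ∂_{a,b} d}`, where `κ` is the invariant form on `𝔰𝔩₂` with
`κ(h,h) = 4`, `κ(e,f) = 2`, `κ(e,e) = κ(f,f) = κ(h,e) = κ(h,f) = 0`. -/
instance : Bracket (SlHat K J) (SlHat K J) where
  bracket x y :=
    { ePart := (2 : K) • (x.hPart * y.ePart) - (2 : K) • (x.ePart * y.hPart)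
        + curlyDer K x.cPart y.ePart - curlyDer K y.cPart x.ePart
      hPart := x.ePart * y.fPart - x.fPart * y.ePart
        + curlyDer K x.cPart y.hPart - curlyDer K y.cPart x.hPart
      fPart := (2 : K) • (x.fPart * y.hPart) - (2 : K) • (x.hPart * y.fPart)
        + curlyDer K x.cPart y.fPart - curlyDer K y.cPart x.fPart
      cPart := (4 : K) • curly K x.hPart y.hPart + (2 : K) • curly K x.ePart y.fPart
        + (2 : K) • curly K x.fPart y.ePart + curlyAct K x.cPart y.cPart }

theorem lie_ePart (x y : SlHat K J) : ⁅x, y⁆.ePart =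
    (2 : K) • (x.hPart * y.ePart) - (2 : K) • (x.ePart * y.hPart)
      + curlyDer K x.cPart y.ePart - curlyDer K y.cPart x.ePart := rfl

theorem lie_hPart (x y : SlHat K J) : ⁅x, y⁆.hPart =
    x.ePart * y.fPart - x.fPart * y.ePart
      + curlyDer K x.cPart y.hPart - curlyDer K y.cPart x.hPart := rfl

theorem lie_fPart (x y : SlHat K J) : ⁅x, y⁆.fPart =
    (2 : K) • (x.fPart * y.hPart) - (2 : K) • (x.hPart * y.fPart)
      + curlyDer K x.cPart y.fPart - curlyDer K y.cPart x.fPart := rfl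

theorem lie_cPart (x y : SlHat K J) : ⁅x, y⁆.cPart =
    (4 : K) • curly K x.hPart y.hPart + (2 : K) • curly K x.ePart y.fPart
      + (2 : K) • curly K x.fPart y.ePart + curlyAct K x.cPart y.cPart := rfl

theorem add_lie' (x y z : SlHat K J) : ⁅x + y, z⁆ = ⁅x, z⁆ + ⁅y, z⁆ := by
  ext <;> simp only [lie_ePart, lie_hPart, lie_fPart, lie_cPart, add_ePart, add_hPart, add_fPart,
    add_cPart, add_mul, curly_add_left, map_add, LinearMap.add_apply] <;> module

theorem lie_skew' (x y : SlHat K J) : ⁅x, y⁆ = -⁅y, x⁆ := by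
  rw [← neg_one_smul K ⁅y, x⁆]
  ext
  · simp only [lie_ePart, smul_ePart, mul_comm]
    module
  · simp only [lie_hPart, smul_hPart, mul_comm]
    module
  · simp only [lie_fPart, smul_fPart, mul_comm]
    module
  · simp only [lie_cPart, smul_cPart]
    rw [curlyAct_skew, curly_skew K x.hPart, curly_skew K x.ePart, curly_skew K x.fPart]
    module

theorem lie_self' (x : SlHat K J) : ⁅x, x⁆ = 0 := by
  have h2 : (2 : K) • ⁅x, x⁆ = 0 := by
    rw [two_smul]
    nth_rw 1 [lie_skew' x x]
    exact neg_add_cancel _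
  exact (smul_eq_zero.1 h2).resolve_left two_ne_zero

theorem lie_add' (x y z : SlHat K J) : ⁅x, y + z⁆ = ⁅x, y⁆ + ⁅x, z⁆ := by
  rw [lie_skew', add_lie', neg_add, ← lie_skew', ← lie_skew']

theorem lie_smul' (t : K) (x y : SlHat K J) : ⁅x, t • y⁆ = t • ⁅x, y⁆ := by
  ext <;> simp only [lie_ePart, lie_hPart, lie_fPart, lie_cPart, smul_ePart, smul_hPart, smul_fPart,
    smul_cPart, mul_smul_comm, curly_smul_right, map_smul, LinearMap.smul_apply] <;> module

theorem leibniz' (x y z : SlHat K J) : ⁅x, ⁅y, z⁆⁆ = ⁅⁅x, y⁆, z⁆ + ⁅y, ⁅x, z⁆⁆ := by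
  obtain ⟨a, b, c, p⟩ := x
  obtain ⟨a', b', c', p'⟩ := y
  obtain ⟨a'', b'', c'', p''⟩ := z
  ext
  · simp only [lie_ePart, lie_hPart, lie_fPart, lie_cPart, add_ePart, map_add, map_sub, map_smul,
      LinearMap.add_apply, LinearMap.smul_apply, curlyDer_mul, curlyDer_act, curlyDer_curly_apply,
      mul_add, add_mul, mul_sub, sub_mul, mul_smul_comm, smul_mul_assoc]
    simp only [mul_comm]
    module
  · simp only [lie_ePart, lie_hPart, lie_fPart, lie_cPart, add_hPart, map_add, map_sub, map_smul,
      LinearMap.add_apply, LinearMap.smul_apply, curlyDer_mul, curlyDer_act, curlyDer_curly_apply,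
      mul_add, add_mul, mul_sub, sub_mul, mul_smul_comm, smul_mul_assoc]
    simp only [mul_comm]
    module
  · simp only [lie_ePart, lie_hPart, lie_fPart, lie_cPart, add_fPart, map_add, map_sub, map_smul,
      LinearMap.add_apply, LinearMap.smul_apply, curlyDer_mul, curlyDer_act, curlyDer_curly_apply,
      mul_add, add_mul, mul_sub, sub_mul, mul_smul_comm, smul_mul_assoc]
    simp only [mul_comm]
    module
  · simp only [lie_ePart, lie_hPart, lie_fPart, lie_cPart, add_cPart, map_add, map_sub, map_smul,
      LinearMap.add_apply, LinearMap.smul_apply, curlyAct_act, curlyAct_curly, curly_add_left,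
      curly_add_right, curly_sub_left, curly_sub_right, curly_smul_left, curly_smul_right]
    have hs : ∀ x y : J, curlyAct K (curly K x y) p'' =
        curly K y (curlyDer K p'' x) - curly K x (curlyDer K p'' y) := by
      intro x y
      rw [curlyAct_skew, curlyAct_curly, curly_skew K (curlyDer K p'' x) y]
      abel
    rw [hs b b', hs a c', hs c a']
    have h1 := curly_cyclic K b a' c''
    have h2 := curly_cyclic K b c' a''
    have h3 := curly_cyclic K a c' b''
    have h4 := curly_cyclic K a b' c''
    have h5 := curly_cyclic K c b' a''
    have h6 := curly_cyclic K c a' b''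
    rw [mul_comm c'' b, curly_skew K (a' * c''), curly_skew K (b * c'')] at h1
    rw [mul_comm a'' b, curly_skew K (c' * a''), curly_skew K (b * a'')] at h2
    rw [mul_comm b'' a, curly_skew K (c' * b''), curly_skew K (a * b'')] at h3
    rw [mul_comm c'' a, curly_skew K (b' * c''), curly_skew K (a * c'')] at h4
    rw [mul_comm a'' c, curly_skew K (b' * a''), curly_skew K (c * a'')] at h5
    rw [mul_comm b'' c, curly_skew K (a' * b''), curly_skew K (c * b'')] at h6
    linear_combination (norm := module) (-4 : K) • h1 + (4 : K) • h2 - (4 : K) • h3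
      + (4 : K) • h4 - (4 : K) • h5 + (4 : K) • h6

instance : LieRing (SlHat K J) where
  add_lie := add_lie'
  lie_add := lie_add'
  lie_self := lie_self'
  leibniz_lie := leibniz'

instance : LieAlgebra K (SlHat K J) where
  lie_smul := lie_smul'

theorem lie_e_e (a b : J) : ⁅e K a, e K b⁆ = 0 := by
  ext <;> simp [lie_ePart, lie_hPart, lie_fPart, lie_cPart, e, curly_zero_left, curly_zero_right]

theorem lie_f_f (a b : J) : ⁅f K a, f K b⁆ = 0 := by
  ext <;> simp [lie_ePart, lie_hPart, lie_fPart, lie_cPart, f, curly_zero_left, curly_zero_right]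

theorem lie_h_h (a b : J) : ⁅h K a, h K b⁆ = (4 : K) • c K J (curly K a b) := by
  ext <;> simp [lie_ePart, lie_hPart, lie_fPart, lie_cPart, h, c, curly_zero_left]

theorem lie_h_e (a b : J) : ⁅h K a, e K b⁆ = (2 : K) • e K (a * b) := by
  ext <;> simp [lie_ePart, lie_hPart, lie_fPart, lie_cPart, h, e, curly_zero_left,
    curly_zero_right]

theorem lie_h_f (a b : J) : ⁅h K a, f K b⁆ = -((2 : K) • f K (a * b)) := by
  ext <;> simp [lie_ePart, lie_hPart, lie_fPart, lie_cPart, h, f, curly_zero_left,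
    curly_zero_right]

theorem lie_e_f (a b : J) :
    ⁅e K a, f K b⁆ = h K (a * b) + (2 : K) • c K J (curly K a b) := by
  ext <;> simp [lie_ePart, lie_hPart, lie_fPart, lie_cPart, e, h, f, c, curly_zero_left]

theorem lie_c_e (p : Curly K J) (a : J) : ⁅c K J p, e K a⁆ = e K (curlyDer K p a) := by
  ext <;> simp [lie_ePart, lie_hPart, lie_fPart, lie_cPart, e, c, curly_zero_left]

theorem lie_c_h (p : Curly K J) (a : J) : ⁅c K J p, h K a⁆ = h K (curlyDer K p a) := by
  ext <;> simp [lie_ePart, lie_hPart, lie_fPart, lie_cPart, h, c, curly_zero_left]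

theorem lie_c_f (p : Curly K J) (a : J) : ⁅c K J p, f K a⁆ = f K (curlyDer K p a) := by
  ext <;> simp [lie_ePart, lie_hPart, lie_fPart, lie_cPart, f, c, curly_zero_left]

theorem lie_c_c (p q : Curly K J) : ⁅c K J p, c K J q⁆ = c K J (curlyAct K p q) := by
  ext <;> simp [lie_ePart, lie_hPart, lie_fPart, lie_cPart, c, curly_zero_left]

end SlHat

end LieAlgebra

section Modules

/-- A `J`-space structure on a vector space `V`. -/
structure IsJSpace {K : Type u} {J : Type v} {V : Type w} [Field K] [NonAssocCommRing J]
    [Module K J] [IsScalarTower K J J] [SMulCommClass K J J] [AddCommGroup V] [Module K V]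
    (ρ : J →ₗ[K] Module.End K V) : Prop where
  /-- `[ρ(a), ρ(a²)] = 0`. -/
  lie_sq : ∀ a : J, ⁅ρ a, ρ (a * a)⁆ = 0
  /-- `[[ρ(a), ρ(b)], ρ(c)] = 4 ρ(∂_{a,b} c)`. -/
  lie_lie : ∀ a b c : J, ⁅⁅ρ a, ρ b⁆, ρ c⁆ = (4 : K) • ρ (innerDer K a b c)

variable (K : Type u) (J : Type v) [Field K] [CharZero K] [NonAssocCommRing J] [IsCommJordan J]
  [Module K J] [IsScalarTower K J J] [SMulCommClass K J J]
  (X : Type w) [AddCommGroup X] [Module K X] [LieRingModule (SlHat K J) X]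
  [LieModule K (SlHat K J) X]

/-- `X` is an `(𝔰𝔩₂^(J), SL₂)`-module: it is locally finite under `𝔰𝔩₂ = 𝔰𝔩₂ ⊗ 1`, i.e. every
vector lies in a finite-dimensional subspace stable under `e`, `h` and `f`. -/
def IsSL2Module : Prop :=
  ∀ x : X, ∃ W : Submodule K X, FiniteDimensional K W ∧ x ∈ W ∧
    ∀ y ∈ W, ⁅SlHat.e K (1 : J), y⁆ ∈ W ∧ ⁅SlHat.h K (1 : J), y⁆ ∈ W ∧ ⁅SlHat.f K (1 : J), y⁆ ∈ W

/-- `H⁰(𝔊₂, X)`: the vectors of `X` killed by `𝔊₂ = e ⊗ J`. -/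
def H0 : Submodule K X where
  carrier := {x | ∀ a : J, ⁅SlHat.e K a, x⁆ = 0}
  zero_mem' a := lie_zero _
  add_mem' hx hy a := by rw [lie_add, hx a, hy a, add_zero]
  smul_mem' t x hx a := by rw [lie_smul, hx a, smul_zero]

theorem h_mem_H0 (a : J) {x : X} (hx : x ∈ H0 K J X) : ⁅SlHat.h K a, x⁆ ∈ H0 K J X := by
  intro b
  rw [leibniz_lie, hx b, lie_zero, add_zero, ← lie_skew, SlHat.lie_h_e, neg_lie, smul_lie,
    hx (a * b), smul_zero, neg_zero]

/-- The action of `h(a)`, `a ∈ J`, on `H⁰(𝔊₂, X)`. -/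
def H0.rho : J →ₗ[K] Module.End K (H0 K J X) where
  toFun a :=
    { toFun := fun x => ⟨⁅SlHat.h K a, (x : X)⁆, h_mem_H0 K J X a x.2⟩
      map_add' := fun x y => Subtype.ext (lie_add _ _ _)
      map_smul' := fun t x => Subtype.ext (lie_smul _ _ _) }
  map_add' a b := by
    ext x
    simp
  map_smul' t a := by
    ext x
    simp

theorem H0.rho_apply (a : J) (x : H0 K J X) :
    (H0.rho K J X a x : X) = ⁅SlHat.h K a, (x : X)⁆ := rfl

/-- `H⁰(𝔊₂, X)` is a `J`-space. -/
theorem H0.isJSpace : IsJSpace (H0.rho K J X) where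
  lie_sq a := by
    ext x
    simp only [LieRing.of_associative_ring_bracket, LinearMap.sub_apply, Module.End.mul_apply,
      Submodule.coe_sub, H0.rho_apply, ← lie_lie, SlHat.lie_h_h, curly_sq, map_zero, smul_zero,
      zero_lie, LinearMap.zero_apply, Submodule.coe_zero]
  lie_lie a b c := by
    ext x
    have h1 : ∀ y : H0 K J X, ((⁅H0.rho K J X a, H0.rho K J X b⁆ y : H0 K J X) : X) =
        ⁅⁅SlHat.h K a, SlHat.h K b⁆, (y : X)⁆ := fun y => by
      simp only [LieRing.of_associative_ring_bracket, LinearMap.sub_apply, Module.End.mul_apply,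
        Submodule.coe_sub, H0.rho_apply, ← lie_lie]
    rw [LieRing.of_associative_ring_bracket, LinearMap.sub_apply, Module.End.mul_apply,
      Module.End.mul_apply, Submodule.coe_sub, h1, H0.rho_apply, H0.rho_apply, h1, ← lie_lie,
      SlHat.lie_h_h, smul_lie, SlHat.lie_c_h, curlyDer_curly, LinearMap.smul_apply,
      Submodule.coe_smul, H0.rho_apply, smul_lie]

end Modules

section Dominance

variable {K : Type u} {J : Type v} {V : Type w} [Field K] [CharZero K] [NonAssocCommRing J]
  [IsCommJordan J] [Module K J] [IsScalarTower K J J] [SMulCommClass K J J] [AddCommGroup V]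
  [Module K V]

/-- The `J`-space `(V, ρ)` is dominant: it is isomorphic to a `J`-subspace of `H⁰(𝔊₂, X)` for some
`(𝔰𝔩₂^(J), SL₂)`-module `X`. -/
def IsDominant (ρ : J →ₗ[K] Module.End K V) : Prop :=
  ∃ (X : Type (max u v w)) (_ : AddCommGroup X) (_ : Module K X)
    (_ : LieRingModule (SlHat K J) X) (_ : LieModule K (SlHat K J) X),
    IsSL2Module K J X ∧
      ∃ φ : V →ₗ[K] H0 K J X, Function.Injective φ ∧ ∀ a x, φ (ρ a x) = H0.rho K J X a (φ x)

/-- The powers of an element of a (power-associative) unital algebra. -/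
def jpow {J : Type v} [NonAssocCommRing J] (a : J) : ℕ → J
  | 0 => 1
  | k + 1 => jpow a k * a

/-- `|C_σ|`: the number of permutations with cycle lengths `σ₁, …, σ_m` (fixed points included). -/
def cycleClassCard {N : ℕ} (σ : N.Partition) : ℕ :=
  Fintype.card {τ : Equiv.Perm (Fin N) // τ.partition.parts = σ.parts}

/-- `sgn(σ)`: the sign of a permutation with cycle lengths `σ₁, …, σ_m`, a cycle of length `k`
having sign `(-1)^(k+1)`. -/
def partitionSign {N : ℕ} (σ : N.Partition) : ℤ :=
  (σ.parts.map fun k => (-1 : ℤ) ^ (k + 1)).prod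

theorem sign_eq_partitionSign {N : ℕ} (σ : N.Partition) (τ : Equiv.Perm (Fin N))
    (h : τ.partition.parts = σ.parts) : (Equiv.Perm.sign τ : ℤ) = partitionSign σ := by
  rw [partitionSign, ← h, Equiv.Perm.parts_partition, Multiset.map_add, Multiset.prod_add,
    Multiset.map_replicate, Equiv.Perm.sign_of_cycleType']
  have h2 : ((τ.cycleType.map fun k => -(-1 : ℤˣ) ^ k).prod : ℤ) =
      (τ.cycleType.map fun k => (-1 : ℤ) ^ (k + 1)).prod := by
    induction τ.cycleType using Multiset.induction_on with
    | empty => simp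
    | cons k s ih =>
      simp only [Multiset.map_cons, Multiset.prod_cons, Units.val_mul, ih]
      congr 1
      simp [pow_succ]
  rw [h2]
  simp

/-- `ρ_σ(a) = ρ(a^{σ₁}) ρ(a^{σ₂}) ⋯ ρ(a^{σ_m})`, where `σ₁ ≥ σ₂ ≥ ⋯ ≥ σ_m`. -/
def rhoPartition (ρ : J →ₗ[K] Module.End K V) {N : ℕ} (σ : N.Partition) (a : J) :
    Module.End K V :=
  ((σ.parts.sort (· ≥ ·)).map fun k => ρ (jpow a k)).prod

end Dominance

end TitsAllisonGao

/-!
Write `e_N(a)` for `∑ sgn(σ) |C_σ| ρ_σ(a) / N!`, the sum over `σ ⊢ N`: it is the elementary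
symmetric function `e_N` written in power sums `p_k` and evaluated at `p_k = ρ(a^k)`
(`esymmRho`). Jordan algebras are power associative and the symbols `{a^i, a^j}` vanish, so the
`ρ(a^k)` commute, and the orbit-stabilizer formula for `|C_σ|` turns into Newton's identity
(`esymmRho_succ`).

Both directions rest on Garland's formula (`toEnd_e_pow_toEnd_f_pow`): if `x` is killed by `e ⊗ J`,
then `e(a)^N f(1)^N x = (N!)² e_N(a) x`. With the generating series `F = ∑ (-1)^k f(a^k) u^k` and
`H = ∑ (-1)^k h(a^{k+1}) u^k` one has `[e(a), F] = H`, `[H, F] = 2 F'`, and Newton's identity reads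
`e' = H e`. Hence `e(a) F^{m+1} e x = (m+1) (F^m e)' x`, and iterating this gives the formula.

If `V` is dominant, `f(1)^{n+1}` kills its image in `X` because `X` is locally finite over `𝔰𝔩₂`
(`toEnd_f_pow_eq_zero`), so Garland's formula gives `e_{n+1}(a) = 0`.

Conversely, let `(h ⊗ J) ⊕ (f ⊗ J) ⊕ {J,J}` act on `V` with `f ⊗ J` acting by zero, and consider the
coinduced module `Coind`, that is `Hom (Sym J, V)`. Realizing it by an explicit recursion
(`coindAct`) avoids the Poincaré-Birkhoff-Witt theorem. The constants form a copy of `V` killed by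
`e ⊗ J`. For a constant `v`, the vector `f(1)^{n+1} v` is homogeneous of degree `n + 1` by its weight,
and its value at `a^{n+1}` is that of `e(a)^{n+1} f(1)^{n+1} v` in degree zero, a multiple of
`e_{n+1}(a) v = 0`. By polarization `f(1)^{n+1} v = 0` (`toEnd_f_pow_const_eq_zero`), so `V` lies in
the submodule of `𝔰𝔩₂`-finite vectors, which is the required `X`.
-/

namespace TitsAllisonGao

universe u v w

set_option linter.unusedSectionVars false

/-! ### Power associativity -/

section PowerAssociativity

variable (K : Type u) {J : Type v} [Field K] [CharZero K] [NonAssocCommRing J]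
  [IsCommJordan J] [Module K J] [IsScalarTower K J J] [SMulCommClass K J J]

theorem jpow_zero (a : J) : jpow a 0 = 1 := rfl

theorem jpow_succ (a : J) (k : ℕ) : jpow a (k + 1) = jpow a k * a := rfl

theorem jpow_one (a : J) : jpow a 1 = a := one_mul a

include K

/-- The linearized Jordan identity, read as an identity of multiplication operators: it expresses
`L_{(bc)d}` through the multiplications by `b`, `c`, `d` and their pairwise products. -/
theorem mul_mul_mul_eq (b c d x : J) :
    ((b * c) * d) * x = (b * c) * (d * x) + (b * d) * (c * x) + (c * d) * (b * x)
      - b * (d * (c * x)) - c * (d * (b * x)) := by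
  have h := jordan_linearized K x b c d
  simp only [mul_comm] at h ⊢
  linear_combination (norm := module) h

/-- `L_{a^k}` commutes with `L_a` and with `L_{a²}`. -/
theorem jpow_mul_left_comm (a : J) (k : ℕ) :
    (∀ x, jpow a k * (a * x) = a * (jpow a k * x)) ∧
      ∀ x, jpow a k * ((a * a) * x) = (a * a) * (jpow a k * x) := by
  have h2 : ∀ x, a * ((a * a) * x) = (a * a) * (a * x) := fun x =>
    DFunLike.congr_fun (commute_lmul_lmul_sq a).eq x
  induction k using Nat.strong_induction_on with
  | _ k ih =>
    match k with
    | 0 => simp [jpow_zero]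
    | 1 => simp only [jpow_one]; exact ⟨fun _ => trivial, h2⟩
    | k + 2 =>
      have h : ∀ x, jpow a (k + 2) * x = jpow a (k + 1) * (a * x) + jpow a (k + 1) * (a * x)
          + (a * a) * (jpow a k * x) - jpow a k * (a * (a * x)) - a * (a * (jpow a k * x)) := by
        intro x
        rw [jpow_succ, jpow_succ, mul_mul_mul_eq K]
      obtain ⟨h0, h0'⟩ := ih k (by omega)
      obtain ⟨h1, h1'⟩ := ih (k + 1) (by omega)
      constructor <;> intro x <;>
        simp only [h, mul_add, mul_sub, h0, h1, h0', h1', h2]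

/-- Jordan algebras are power associative. -/
theorem jpow_mul_jpow (a : J) (i j : ℕ) : jpow a i * jpow a j = jpow a (i + j) := by
  induction j with
  | zero => rw [jpow_zero, mul_one, add_zero]
  | succ j ih =>
    rw [jpow_succ, mul_comm (jpow a j), (jpow_mul_left_comm K a i).1, ih, mul_comm, ← jpow_succ,
      add_assoc]

theorem curly_one_right (a : J) : curly K a 1 = 0 := by
  have h := curly_cyclic K 1 1 a
  rw [mul_one, mul_one, one_mul, curly_skew K 1 a, neg_add_cancel, zero_add] at h
  exact h

/-- The symbols `{a^i, a^j}` vanish. The cyclic relation gives `{a^i, a^j} = j {a^{i+j-1}, a}`, so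
skew symmetry makes them `(i + j)`-torsion. -/
theorem curly_jpow_jpow (a : J) (i j : ℕ) : curly K (jpow a i) (jpow a j) = 0 := by
  have step : ∀ j i, curly K (jpow a i) (jpow a (j + 1)) =
      ((j + 1 : ℕ) : K) • curly K (jpow a (i + j)) a := by
    intro j
    induction j with
    | zero => intro i; simp [jpow_one]
    | succ j ih =>
      intro i
      have h := curly_cyclic K (jpow a (j + 1)) a (jpow a i)
      rw [← jpow_succ, mul_comm a, ← jpow_succ, jpow_mul_jpow K, curly_skew K (jpow a (j + 1 + 1)),
        ih] at h
      rw [show i + (j + 1) = i + 1 + j by ring]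
      rw [show i + (j + 1) = i + 1 + j by ring] at h
      push_cast at h ⊢
      linear_combination (norm := module) (-1 : K) • h
  match i, j with
  | 0, j => rw [curly_skew, jpow_zero, curly_one_right, neg_zero]
  | i, 0 => rw [jpow_zero, curly_one_right]
  | i + 1, j + 1 =>
    have h1 := step j (i + 1)
    have h2 := step i (j + 1)
    rw [curly_skew, h1, show j + 1 + i = i + 1 + j by ring] at h2
    have h3 : ((i + j + 2 : ℕ) : K) • curly K (jpow a (i + 1 + j)) a = 0 := by
      push_cast at h2 ⊢
      linear_combination (norm := module) (-1 : K) • h2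
    rw [h1, (smul_eq_zero.1 h3).resolve_left (Nat.cast_ne_zero.2 (by omega)), smul_zero]

end PowerAssociativity

/-! ### Conjugacy classes of symmetric groups and Newton's identity -/

section PartitionSums

open scoped Nat

/-- The order of the centralizer of a permutation with cycle lengths `s`, fixed points included. -/
def centralizerOrder (s : Multiset ℕ) : ℕ := s.prod * ∏ k ∈ s.toFinset, (s.count k)!

theorem centralizerOrder_cons (k : ℕ) (s : Multiset ℕ) :
    centralizerOrder (k ::ₘ s) = k * (s.count k + 1) * centralizerOrder s := by
  have h : ∏ i ∈ (k ::ₘ s).toFinset, ((k ::ₘ s).count i)! =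
      (s.count k + 1) * ∏ i ∈ s.toFinset, (s.count i)! := by
    have h1 : ∏ i ∈ s.toFinset, (s.count i)! = ∏ i ∈ (k ::ₘ s).toFinset, (s.count i)! := by
      refine Finset.prod_subset (fun i hi => ?_) fun i _ hi => ?_
      · simp only [Multiset.mem_toFinset, Multiset.mem_cons] at hi ⊢
        exact Or.inr hi
      · rw [Multiset.mem_toFinset] at hi
        rw [Multiset.count_eq_zero_of_notMem hi, Nat.factorial_zero]
    have hk : k ∈ (k ::ₘ s).toFinset := by simp
    rw [h1, ← Finset.mul_prod_erase _ _ hk, ← Finset.mul_prod_erase _ _ hk,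
      Multiset.count_cons_self, Nat.factorial_succ, mul_assoc]
    congr 2
    refine Finset.prod_congr rfl fun i hi => ?_
    rw [Multiset.count_cons_of_ne (Finset.ne_of_mem_erase hi)]
  rw [centralizerOrder, h, Multiset.prod_cons, centralizerOrder]
  ring

theorem centralizerOrder_pos {s : Multiset ℕ} (hs : ∀ k ∈ s, 0 < k) : 0 < centralizerOrder s :=
  Nat.mul_pos (Multiset.prod_pos hs) (Finset.prod_pos fun _ _ => Nat.factorial_pos _)

theorem centralizerOrder_add_replicate_one {s : Multiset ℕ} (hs : ∀ k ∈ s, 2 ≤ k) (m : ℕ) :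
    centralizerOrder (s + Multiset.replicate m 1) = m ! * centralizerOrder s := by
  induction m with
  | zero => simp
  | succ m ih =>
    have h1 : s.count 1 = 0 :=
      Multiset.count_eq_zero_of_notMem fun h => absurd (hs 1 h) (by norm_num)
    rw [Multiset.replicate_succ, Multiset.add_cons, centralizerOrder_cons, ih, Multiset.count_add,
      h1, Multiset.count_replicate_self, Nat.factorial_succ]
    ring

/-- The orbit-stabilizer formula for a conjugacy class of the symmetric group. -/
theorem cycleClassCard_mul {N : ℕ} (σ : N.Partition) :
    cycleClassCard σ * centralizerOrder σ.parts = N ! := by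
  set s := σ.parts.filter (2 ≤ ·) with hs
  have hs2 : ∀ k ∈ s, 2 ≤ k := fun k hk => (Multiset.mem_filter.1 hk).2
  -- `m` is the number of fixed points, which `Equiv.Perm.cycleType` leaves out
  obtain ⟨m, hm⟩ : ∃ m, σ.parts = s + Multiset.replicate m 1 := by
    refine ⟨(σ.parts.filter fun k => ¬ 2 ≤ k).card, ?_⟩
    have h1 : σ.parts.filter (fun k => ¬ 2 ≤ k) =
        Multiset.replicate (σ.parts.filter fun k => ¬ 2 ≤ k).card 1 := by
      rw [Multiset.eq_replicate_card]
      intro k hk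
      obtain ⟨h1, h2⟩ := Multiset.mem_filter.1 hk
      have := σ.parts_pos h1
      omega
    rw [← h1, Multiset.filter_add_not]
  have hsum : s.sum + m = N := by
    rw [← σ.parts_sum, hm, Multiset.sum_add, Multiset.sum_replicate, smul_eq_mul, mul_one]
  have hcard : cycleClassCard σ =
      (Finset.univ.filter fun g : Equiv.Perm (Fin N) => g.cycleType = s).card := by
    rw [cycleClassCard, Fintype.card_subtype]
    congr 1
    ext τ
    simp only [Finset.mem_filter, Finset.mem_univ, true_and]
    constructor
    · intro h
      rw [← Equiv.Perm.filter_parts_partition_eq_cycleType, h]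
    · intro h
      rw [Equiv.Perm.parts_partition, hm, h, ← Equiv.Perm.sum_cycleType, h, Fintype.card_fin]
      congr 2
      omega
  have h := Equiv.Perm.card_of_cycleType_mul_eq (Fin N) s
  rw [Fintype.card_fin, if_pos ⟨by omega, hs2⟩, ← hcard, show N - s.sum = m by omega, mul_assoc,
    ← centralizerOrder, ← centralizerOrder_add_replicate_one hs2, ← hm] at h
  exact h

variable {K : Type u} {J : Type v} {V : Type w} [Field K] [CharZero K] [NonAssocCommRing J]
  [IsCommJordan J] [Module K J] [IsScalarTower K J J] [SMulCommClass K J J] [AddCommGroup V]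
  [Module K V] {ρ : J →ₗ[K] Module.End K V}

/-- The linear map `{J,J} → End V`, `{a,b} ↦ [ρ(a), ρ(b)]`, attached to a `J`-space. -/
def curlyRho (hρ : IsJSpace ρ) : Curly K J →ₗ[K] Module.End K V :=
  curlyLift K
    (LinearMap.mk₂ K (fun a b => ⁅ρ a, ρ b⁆)
      (fun a a' b => by simp only [Ring.lie_def, map_add, add_mul, mul_add]; abel)
      (fun t a b => by simp only [Ring.lie_def, map_smul, smul_mul_assoc, mul_smul_comm, smul_sub])
      (fun a b b' => by simp only [Ring.lie_def, map_add, add_mul, mul_add]; abel)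
      (fun t a b => by simp only [Ring.lie_def, map_smul, smul_mul_assoc, mul_smul_comm, smul_sub]))
    (fun a => by simp only [LinearMap.mk₂_apply, Ring.lie_def, sub_self])
    (fun a => by rw [LinearMap.mk₂_apply]; exact hρ.lie_sq a)

theorem curlyRho_curly (hρ : IsJSpace ρ) (a b : J) : curlyRho hρ (curly K a b) = ⁅ρ a, ρ b⁆ :=
  curlyLift_curly K _ _ _ a b

theorem IsJSpace.commute_jpow (hρ : IsJSpace ρ) (a : J) (i j : ℕ) :
    Commute (ρ (jpow a i)) (ρ (jpow a j)) := by
  rw [commute_iff_lie_eq, ← curlyRho_curly hρ, curly_jpow_jpow, map_zero]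

variable (ρ) in
/-- The product of the `ρ(a^k)`, `k` running through a multiset in decreasing order. -/
def rhoMultiset (s : Multiset ℕ) (a : J) : Module.End K V :=
  ((s.sort (· ≥ ·)).map fun k => ρ (jpow a k)).prod

theorem rhoMultiset_cons (hρ : IsJSpace ρ) (k : ℕ) (s : Multiset ℕ) (a : J) :
    rhoMultiset ρ (k ::ₘ s) a = ρ (jpow a k) * rhoMultiset ρ s a := by
  have hp : ((k ::ₘ s).sort (· ≥ ·)).Perm (k :: s.sort (· ≥ ·)) := by
    rw [← Multiset.coe_eq_coe, Multiset.sort_eq, ← Multiset.cons_coe, Multiset.sort_eq]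
  rw [rhoMultiset, rhoMultiset, ← List.prod_cons, ← List.map_cons (f := fun k => ρ (jpow a k))]
  refine (hp.map _).prod_eq' ?_
  have hc : ∀ x ∈ ((k ::ₘ s).sort (· ≥ ·)).map fun k => ρ (jpow a k),
      ∀ y ∈ ((k ::ₘ s).sort (· ≥ ·)).map fun k => ρ (jpow a k), Commute x y := by
    simp only [List.mem_map]
    rintro _ ⟨i, _, rfl⟩ _ ⟨j, _, rfl⟩
    exact hρ.commute_jpow a i j
  exact List.pairwise_of_forall_mem_list hc

variable (ρ) in
/-- The elementary symmetric function `e_N` expressed through power sums, evaluated at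
`p_k = ρ(a^k)`: the sum over `σ ⊢ N` of `sgn(σ) |C_σ| ρ_σ(a) / N!`. -/
def esymmRho (a : J) (N : ℕ) : Module.End K V :=
  ∑ σ : N.Partition, ((partitionSign σ : K) / centralizerOrder σ.parts) • rhoMultiset ρ σ.parts a

variable (ρ) in
theorem sum_partition_eq (a : J) (N : ℕ) :
    ∑ σ : N.Partition, (partitionSign σ * (cycleClassCard σ : ℤ)) • rhoPartition ρ σ a =
      (N ! : K) • esymmRho ρ a N := by
  rw [esymmRho, Finset.smul_sum]
  refine Finset.sum_congr rfl fun σ _ => ?_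
  have h0 : (centralizerOrder σ.parts : K) ≠ 0 :=
    Nat.cast_ne_zero.2 (centralizerOrder_pos fun _ => σ.parts_pos).ne'
  rw [← Int.cast_smul_eq_zsmul K, smul_smul, ← cycleClassCard_mul σ]
  congr 1
  push_cast
  field_simp

variable (ρ) in
theorem esymmRho_zero (a : J) : esymmRho ρ a 0 = 1 := by
  rw [esymmRho, Fintype.sum_unique]
  simp [partitionSign, centralizerOrder, rhoMultiset]

/-- Newton's identity `(N+1) e_{N+1} = ∑ (-1)^k p_{k+1} e_{N-k}`. -/
theorem esymmRho_succ (hρ : IsJSpace ρ) (a : J) (N : ℕ) :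
    ((N + 1 : ℕ) : K) • esymmRho ρ a (N + 1) =
      ∑ k ∈ Finset.range (N + 1), (-1 : K) ^ k • (ρ (jpow a (k + 1)) * esymmRho ρ a (N - k)) := by
  -- weigh each partition by its size `∑ k · (multiplicity of k)`
  have hsize : ∀ σ : (N + 1).Partition, ((N + 1 : ℕ) : K) =
      ∑ k ∈ Finset.range (N + 1), (((k + 1) * σ.parts.count (k + 1) : ℕ) : K) := by
    intro σ
    rw [← Nat.cast_sum]
    congr 1
    conv_lhs => rw [← σ.parts_sum]
    rw [Finset.sum_multiset_count_of_subset σ.parts (Finset.range (N + 2)) fun k hk => by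
      rw [Multiset.mem_toFinset] at hk
      have := σ.le_of_mem_parts hk
      rw [Finset.mem_range]
      omega, Finset.sum_range_succ']
    simp [mul_comm]
  have hterm : ∀ k ∈ Finset.range (N + 1), ∑ σ : (N + 1).Partition,
      ((((k + 1) * σ.parts.count (k + 1) : ℕ) : K) *
        ((partitionSign σ : K) / centralizerOrder σ.parts)) • rhoMultiset ρ σ.parts a =
      (-1 : K) ^ k • (ρ (jpow a (k + 1)) * esymmRho ρ a (N - k)) := by
    intro k hk
    rw [Finset.mem_range] at hk
    rw [esymmRho, Finset.mul_sum, Finset.smul_sum]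
    -- only partitions with a part `k + 1` contribute, and deleting that part is a bijection
    let add : (N - k).Partition → (N + 1).Partition := fun τ =>
      { parts := (k + 1) ::ₘ τ.parts
        parts_pos := fun {i} hi => by
          rcases Multiset.mem_cons.1 hi with rfl | hi
          · exact Nat.succ_pos k
          · exact τ.parts_pos hi
        parts_sum := by rw [Multiset.sum_cons, τ.parts_sum]; omega }
    have hadd : ∀ τ, (add τ).parts = (k + 1) ::ₘ τ.parts := fun _ => rfl
    symm
    refine Finset.sum_of_injOn add ?_ (fun _ _ => Finset.mem_coe.2 (Finset.mem_univ _)) ?_ ?_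
    · intro τ _ τ' _ h
      have h' := congrArg Nat.Partition.parts h
      rw [hadd, hadd, Multiset.cons_inj_right] at h'
      exact Nat.Partition.ext h'
    · intro σ _ hσ
      have h0 : σ.parts.count (k + 1) = 0 := by
        refine Multiset.count_eq_zero_of_notMem fun hmem => hσ ?_
        refine ⟨⟨σ.parts.erase (k + 1), fun hi => σ.parts_pos (Multiset.mem_of_mem_erase hi), ?_⟩,
          Finset.mem_coe.2 (Finset.mem_univ _), Nat.Partition.ext (Multiset.cons_erase hmem)⟩
        have h1 := σ.parts_sum
        rw [← Multiset.cons_erase hmem, Multiset.sum_cons] at h1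
        omega
      rw [h0, mul_zero, Nat.cast_zero, zero_mul, zero_smul]
    · intro τ _
      have h0 : (centralizerOrder τ.parts : K) ≠ 0 :=
        Nat.cast_ne_zero.2 (centralizerOrder_pos fun _ => τ.parts_pos).ne'
      have h1 : ((τ.parts.count (k + 1) : K) + 1) ≠ 0 := by
        exact_mod_cast Nat.succ_ne_zero (τ.parts.count (k + 1))
      have h2 : ((k : K) + 1) ≠ 0 := by exact_mod_cast Nat.succ_ne_zero k
      rw [hadd, rhoMultiset_cons hρ, mul_smul_comm, smul_smul, centralizerOrder_cons,
        Multiset.count_cons_self, 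
        show partitionSign (add τ) = (-1) ^ (k + 1 + 1) * partitionSign τ by
          rw [partitionSign, hadd, Multiset.map_cons, Multiset.prod_cons, partitionSign]]
      congr 1
      push_cast
      field_simp
      ring
  rw [← Finset.sum_congr rfl hterm, Finset.sum_comm, esymmRho, Finset.smul_sum]
  refine Finset.sum_congr rfl fun σ _ => ?_
  rw [smul_smul, hsize σ, Finset.sum_mul, Finset.sum_smul]

end PartitionSums

/-! ### Intertwining maps -/

section Intertwining

variable {K : Type u} {J : Type v} {V : Type w} {X : Type*} [Field K] [CharZero K]
  [NonAssocCommRing J] [IsCommJordan J] [Module K J] [IsScalarTower K J J] [SMulCommClass K J J]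
  [AddCommGroup V] [Module K V] [AddCommGroup X] [Module K X]

theorem esymmRho_intertwine {ρ : J →ₗ[K] Module.End K V} {ρ' : J →ₗ[K] Module.End K X}
    (ψ : V →ₗ[K] X) (h : ∀ a x, ψ (ρ a x) = ρ' a (ψ x)) (a : J) (N : ℕ) (x : V) :
    ψ (esymmRho ρ a N x) = esymmRho ρ' a N (ψ x) := by
  simp only [esymmRho, LinearMap.sum_apply, map_sum, LinearMap.smul_apply, map_smul]
  refine Finset.sum_congr rfl fun σ _ => ?_
  congr 1
  rw [rhoMultiset, rhoMultiset]
  induction σ.parts.sort (· ≥ ·) with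
  | nil => rfl
  | cons k l ih =>
    rw [List.map_cons, List.map_cons, List.prod_cons, List.prod_cons, Module.End.mul_apply,
      Module.End.mul_apply, h, ih]

end Intertwining

/-! ### Power series with noncommuting coefficients -/

section PowerSeries

open PowerSeries (C coeff coeff_mk coeff_mul coeff_one)
open scoped PowerSeries

variable {R : Type*} [Ring R]

/-- The formal derivative of a power series with coefficients in a noncommutative ring. -/
noncomputable def seriesDeriv (p : R⟦X⟧) : R⟦X⟧ := PowerSeries.mk fun n => (n + 1) • coeff (n + 1) p

theorem coeff_seriesDeriv (p : R⟦X⟧) (n : ℕ) :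
    coeff n (seriesDeriv p) = (n + 1) • coeff (n + 1) p := coeff_mk _ _

theorem seriesDeriv_one : seriesDeriv (1 : R⟦X⟧) = 0 := by
  ext n
  rw [coeff_seriesDeriv, coeff_one, if_neg n.succ_ne_zero, smul_zero, map_zero]

theorem seriesDeriv_mul (p q : R⟦X⟧) :
    seriesDeriv (p * q) = seriesDeriv p * q + p * seriesDeriv q := by
  ext n
  have h : (n + 1) • coeff (n + 1) (p * q) =
      ∑ x ∈ Finset.HasAntidiagonal.antidiagonal (n + 1), (x.1 • coeff x.1 p) * coeff x.2 q +
      ∑ x ∈ Finset.HasAntidiagonal.antidiagonal (n + 1), coeff x.1 p * (x.2 • coeff x.2 q) := by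
    rw [coeff_mul, Finset.smul_sum, ← Finset.sum_add_distrib]
    refine Finset.sum_congr rfl fun x hx => ?_
    rw [Finset.HasAntidiagonal.mem_antidiagonal] at hx
    rw [← hx, add_smul, smul_mul_assoc, mul_smul_comm]
  rw [coeff_seriesDeriv, h, map_add, coeff_mul, coeff_mul, Finset.Nat.sum_antidiagonal_succ,
    Finset.Nat.sum_antidiagonal_succ']
  simp [coeff_seriesDeriv]

theorem seriesDeriv_pow_succ {F : R⟦X⟧} (hF : Commute F (seriesDeriv F)) (m : ℕ) :
    seriesDeriv (F ^ (m + 1)) = (m + 1) • (F ^ m * seriesDeriv F) := by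
  induction m with
  | zero => simp
  | succ m ih =>
    rw [pow_succ, seriesDeriv_mul, ih, smul_mul_assoc, mul_assoc, ← hF.eq, ← mul_assoc, ← pow_succ,
      ← succ_nsmul]

/-- The commutation rule behind Garland's formula: `E F^{m+1} e = F^{m+1} E e + (m+1) (F^m e)'` if
`[E, F] = H`, `[H, F] = 2 F'` and `e' = H e`. -/
theorem mul_pow_mul_eq {E F H e : R⟦X⟧} (hEF : E * F = F * E + H)
    (hHF : H * F = F * H + 2 • seriesDeriv F) (hF : Commute F (seriesDeriv F))
    (he : seriesDeriv e = H * e) (m : ℕ) :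
    E * (F ^ (m + 1) * e) = F ^ (m + 1) * (E * e) + (m + 1) • seriesDeriv (F ^ m * e) := by
  have key : ∀ m : ℕ, E * F ^ (m + 1) =
      F ^ (m + 1) * E + (m + 1) • (F ^ m * H + seriesDeriv (F ^ m)) := by
    intro m
    induction m with
    | zero => simp [seriesDeriv_one, hEF]
    | succ m ih =>
      have h1 : seriesDeriv (F ^ m) * F = seriesDeriv (F ^ (m + 1)) - F ^ m * seriesDeriv F := by
        rw [pow_succ, seriesDeriv_mul, add_sub_cancel_right]
      have h2 := seriesDeriv_pow_succ hF m
      calc E * F ^ (m + 1 + 1) = E * F ^ (m + 1) * F := by rw [pow_succ _ (m + 1), mul_assoc]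
        _ = F ^ (m + 1) * (E * F) + (m + 1) • (F ^ m * (H * F) + seriesDeriv (F ^ m) * F) := by
          rw [ih, add_mul, smul_mul_assoc, add_mul, mul_assoc, mul_assoc]
        _ = _ := by
          rw [hEF, hHF, h1, succ_nsmul _ (m + 1), smul_add (m + 1) (F ^ (m + 1) * H), mul_add,
            ← mul_assoc, ← pow_succ, mul_add, ← mul_assoc, ← pow_succ, mul_smul_comm, two_smul]
          simp only [smul_add, smul_sub]
          rw [← h2]
          abel
  rw [← mul_assoc, key, add_mul, smul_mul_assoc, add_mul, seriesDeriv_mul, he, mul_assoc,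
    ← mul_assoc (F ^ m), add_comm (F ^ m * H * e)]

end PowerSeries

/-! ### Garland's formula -/

section Garland

open scoped Nat
open PowerSeries (C coeff coeff_mk coeff_mul)
open scoped PowerSeries

variable {K : Type u} {J : Type v} [Field K] [CharZero K]
  [NonAssocCommRing J] [IsCommJordan J] [Module K J] [IsScalarTower K J J] [SMulCommClass K J J]
  {X : Type*} [AddCommGroup X] [Module K X] [LieRingModule (SlHat K J) X]
  [LieModule K (SlHat K J) X]

variable (K J X) in
/-- The action of `h(a)`, `a ∈ J`, on the whole of an `𝔰𝔩₂^(J)`-module. -/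
def hRho : J →ₗ[K] Module.End K X :=
  (LieModule.toEnd K (SlHat K J) X : SlHat K J →ₗ[K] Module.End K X) ∘ₗ SlHat.h K

theorem hRho_apply (a : J) (x : X) : hRho K J X a x = ⁅SlHat.h K a, x⁆ := rfl

variable (K J X) in
theorem isJSpace_hRho : IsJSpace (hRho K J X) where
  lie_sq a := by
    ext x
    rw [Ring.lie_def, LinearMap.sub_apply, Module.End.mul_apply, Module.End.mul_apply]
    simp only [hRho_apply, ← lie_lie, SlHat.lie_h_h, curly_sq, map_zero, smul_zero, zero_lie,
      LinearMap.zero_apply]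
  lie_lie a b c := by
    ext x
    simp only [Ring.lie_def, LinearMap.sub_apply, Module.End.mul_apply, hRho_apply, ← lie_lie,
      SlHat.lie_h_h, LinearMap.smul_apply]
    rw [smul_lie, SlHat.lie_c_h, curlyDer_curly, smul_lie]

theorem esymmRho_mem_H0 (a : J) (N : ℕ) {x : X} (hx : x ∈ H0 K J X) :
    esymmRho (hRho K J X) a N x ∈ H0 K J X := by
  have h := esymmRho_intertwine (ρ := H0.rho K J X) (ρ' := hRho K J X) (H0 K J X).subtype
    (fun _ _ => rfl) a N ⟨x, hx⟩
  rw [Submodule.subtype_apply, Submodule.subtype_apply] at h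
  rw [← h]
  exact Subtype.property _

/-- Garland's formula: on the vectors killed by `e ⊗ J`, the operator `e(a)^N f(1)^N` is `N!` times
the polynomial `∑ sgn(σ) |C_σ| h_σ(a)`. -/
theorem toEnd_e_pow_toEnd_f_pow (a : J) (N : ℕ) {x : X} (hx : x ∈ H0 K J X) :
    (LieModule.toEnd K (SlHat K J) X (SlHat.e K a) ^ N)
      ((LieModule.toEnd K (SlHat K J) X (SlHat.f K (1 : J)) ^ N) x) =
    ((N ! : K) * (N ! : K)) • esymmRho (hRho K J X) a N x := by
  let T := LieModule.toEnd K (SlHat K J) X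
  let F : (Module.End K X)⟦X⟧ := PowerSeries.mk fun k => (-1 : K) ^ k • T (SlHat.f K (jpow a k))
  let H : (Module.End K X)⟦X⟧ :=
    PowerSeries.mk fun k => (-1 : K) ^ k • T (SlHat.h K (jpow a (k + 1)))
  let e : (Module.End K X)⟦X⟧ := PowerSeries.mk fun k => esymmRho (hRho K J X) a k
  have hcomm : ∀ y z : SlHat K J, T y * T z = T z * T y + T ⁅y, z⁆ := fun y z => by
    ext x
    simp [T]
  have hEF : C (T (SlHat.e K a)) * F = F * C (T (SlHat.e K a)) + H := by
    ext1 k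
    have h := curly_jpow_jpow K a 1 k
    rw [jpow_one] at h
    rw [map_add, PowerSeries.coeff_C_mul, PowerSeries.coeff_mul_C, coeff_mk, coeff_mk,
      mul_smul_comm, smul_mul_assoc, hcomm, SlHat.lie_e_f, h, map_zero, smul_zero, add_zero,
      mul_comm a, ← jpow_succ, smul_add]
  have hHF : H * F = F * H + 2 • seriesDeriv F := by
    ext1 k
    have h : ∀ x ∈ Finset.HasAntidiagonal.antidiagonal k, coeff x.1 H * coeff x.2 F =
        coeff x.2 F * coeff x.1 H +
          ((-1 : K) ^ (k + 1) * 2) • T (SlHat.f K (jpow a (k + 1))) := by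
      intro x hx
      rw [Finset.HasAntidiagonal.mem_antidiagonal] at hx
      rw [coeff_mk, coeff_mk, smul_mul_smul_comm, smul_mul_smul_comm, hcomm, SlHat.lie_h_f,
        jpow_mul_jpow K, map_neg, map_smul, ← hx, add_right_comm x.1 1 x.2, smul_add,
        mul_comm ((-1 : K) ^ x.2), smul_neg, smul_smul, ← neg_smul]
      congr 2
      ring
    rw [map_add, coeff_mul, coeff_mul, Finset.sum_congr rfl h, Finset.sum_add_distrib,
      ← Finset.Nat.sum_antidiagonal_swap]
    simp only [Prod.fst_swap, Prod.snd_swap]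
    congr 1
    rw [Finset.sum_const, Finset.Nat.card_antidiagonal, map_nsmul, coeff_seriesDeriv, coeff_mk,
      mul_comm, mul_smul, ofNat_smul_eq_nsmul, smul_comm]
  have hF : Commute F (seriesDeriv F) := by
    have hFF : ∀ i j, Commute (coeff i F) (coeff j F) := fun i j => by
      rw [coeff_mk, coeff_mk]
      refine ((?_ : Commute _ _).smul_left _).smul_right _
      have h := hcomm (SlHat.f K (jpow a i)) (SlHat.f K (jpow a j))
      rwa [SlHat.lie_f_f, map_zero, add_zero] at h
    ext1 k
    rw [coeff_mul, coeff_mul, ← Finset.Nat.sum_antidiagonal_swap]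
    refine Finset.sum_congr rfl fun x _ => ?_
    rw [Prod.fst_swap, Prod.snd_swap, coeff_seriesDeriv]
    exact (hFF _ _).smul_right _
  have he : seriesDeriv e = H * e := by
    ext1 k
    rw [coeff_seriesDeriv, coeff_mk, ← Nat.cast_smul_eq_nsmul K, esymmRho_succ (isJSpace_hRho K J X),
      coeff_mul, Finset.Nat.sum_antidiagonal_eq_sum_range_succ_mk]
    refine Finset.sum_congr rfl fun i _ => ?_
    rw [coeff_mk, coeff_mk, smul_mul_assoc]
    rfl
  have hEe : ∀ k, T (SlHat.e K a) (coeff k e x) = 0 := fun k => by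
    rw [coeff_mk]
    exact esymmRho_mem_H0 a k hx a
  have hstep : ∀ m r, T (SlHat.e K a) ((coeff r (F ^ (m + 1) * e) : Module.End K X) x) =
      ((m + 1 : ℕ) * (r + 1 : ℕ) : K) • coeff (r + 1) (F ^ m * e) x := by
    intro m r
    have h := congrArg (fun p => (coeff r p : Module.End K X) x) (mul_pow_mul_eq hEF hHF hF he m)
    have h0 : coeff r (F ^ (m + 1) * (C (T (SlHat.e K a)) * e)) x = 0 := by
      rw [coeff_mul, LinearMap.sum_apply]
      refine Finset.sum_eq_zero fun y _ => ?_
      rw [PowerSeries.coeff_C_mul, Module.End.mul_apply, Module.End.mul_apply, hEe, map_zero]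
    simp only [PowerSeries.coeff_C_mul, map_add, LinearMap.add_apply, h0, zero_add, map_nsmul,
      coeff_seriesDeriv] at h
    rw [← Module.End.mul_apply, h, mul_smul, Nat.cast_smul_eq_nsmul, Nat.cast_smul_eq_nsmul]
    rfl
  -- `e(a)^r` turns the constant coefficient of `F^(m+r) e` into the `u^r` coefficient of `F^m e`, up
  -- to the factorials that would disappear with divided powers
  have hiter : ∀ r m : ℕ, (m ! : K) • (T (SlHat.e K a) ^ r) (coeff 0 (F ^ (m + r) * e) x) =
      (((m + r)! : K) * (r ! : K)) • coeff r (F ^ m * e) x := by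
    intro r
    induction r with
    | zero => intro m; simp
    | succ r ih =>
      intro m
      have h := congrArg (T (SlHat.e K a)) (ih (m + 1))
      rw [map_smul, map_smul, hstep, ← Module.End.mul_apply, ← pow_succ', smul_smul,
        add_right_comm, Nat.factorial_succ m] at h
      have hm : ((m + 1 : ℕ) : K) ≠ 0 := Nat.cast_ne_zero.2 m.succ_ne_zero
      refine (smul_right_injective X hm) ?_
      simp only
      rw [smul_smul, ← Nat.cast_mul, ← add_assoc, h, smul_smul, Nat.factorial_succ r]
      congr 1
      push_cast
      ring
  have h0 := hiter N 0
  have hF0 : ∀ N : ℕ, coeff 0 (F ^ N * e) = T (SlHat.f K (1 : J)) ^ N := by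
    intro N
    rw [PowerSeries.coeff_zero_eq_constantCoeff_apply, map_mul, map_pow,
      ← PowerSeries.coeff_zero_eq_constantCoeff_apply,
      ← PowerSeries.coeff_zero_eq_constantCoeff_apply, coeff_mk, coeff_mk, esymmRho_zero, mul_one,
      pow_zero, one_smul, jpow_zero]
  rw [zero_add, hF0, pow_zero, one_mul, coeff_mk, Nat.factorial_zero, Nat.cast_one, one_smul] at h0
  exact h0

end Garland

/-! ### Vectors finite under `𝔰𝔩₂` -/

section LocallyFinite

variable (K : Type u) (J : Type v) [Field K] [CharZero K]
  [NonAssocCommRing J] [IsCommJordan J] [Module K J] [IsScalarTower K J J] [SMulCommClass K J J]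
  {X : Type*} [AddCommGroup X] [Module K X] [LieRingModule (SlHat K J) X]
  [LieModule K (SlHat K J) X]

/-- A subspace stable under `𝔰𝔩₂ = 𝔰𝔩₂ ⊗ 1`. -/
def IsSL2Stable (W : Submodule K X) : Prop :=
  ∀ y ∈ W, ⁅SlHat.e K (1 : J), y⁆ ∈ W ∧ ⁅SlHat.h K (1 : J), y⁆ ∈ W ∧ ⁅SlHat.f K (1 : J), y⁆ ∈ W

variable {K J}

theorem isSL2Stable_span {S : Set X} (h : ∀ y ∈ S, ⁅SlHat.e K (1 : J), y⁆ ∈ Submodule.span K S ∧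
    ⁅SlHat.h K (1 : J), y⁆ ∈ Submodule.span K S ∧ ⁅SlHat.f K (1 : J), y⁆ ∈ Submodule.span K S) :
    IsSL2Stable K J (Submodule.span K S) := by
  intro y hy
  induction hy using Submodule.span_induction with
  | mem y hy => exact h y hy
  | zero => simp
  | add y z _ _ hy hz =>
    simp only [lie_add]
    exact ⟨add_mem hy.1 hz.1, add_mem hy.2.1 hz.2.1, add_mem hy.2.2 hz.2.2⟩
  | smul t y _ hy =>
    simp only [lie_smul]
    exact ⟨Submodule.smul_mem _ _ hy.1, Submodule.smul_mem _ _ hy.2.1, Submodule.smul_mem _ _ hy.2.2⟩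

theorem IsSL2Stable.sup {W W' : Submodule K X} (h : IsSL2Stable K J W) (h' : IsSL2Stable K J W') :
    IsSL2Stable K J (W ⊔ W') := by
  intro y hy
  obtain ⟨a, ha, b, hb, rfl⟩ := Submodule.mem_sup.1 hy
  simp only [lie_add]
  exact ⟨Submodule.add_mem_sup (h a ha).1 (h' b hb).1,
    Submodule.add_mem_sup (h a ha).2.1 (h' b hb).2.1,
    Submodule.add_mem_sup (h a ha).2.2 (h' b hb).2.2⟩

variable (K J X) in
/-- The `𝔰𝔩₂`-finite vectors of an `𝔰𝔩₂^(J)`-module, as a subspace. -/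
def sl2FiniteSubmodule : Submodule K X where
  carrier := {x | ∃ W : Submodule K X, FiniteDimensional K W ∧ x ∈ W ∧ IsSL2Stable K J W}
  zero_mem' := ⟨⊥, inferInstance, zero_mem _, fun y hy => by
    rw [Submodule.mem_bot] at hy
    simp [hy]⟩
  add_mem' := by
    rintro x y ⟨W, _, hx, hW⟩ ⟨W', _, hy, hW'⟩
    exact ⟨W ⊔ W', inferInstance, Submodule.add_mem_sup hx hy, hW.sup hW'⟩
  smul_mem' := by
    rintro t x ⟨W, hf, hx, hW⟩
    exact ⟨W, hf, W.smul_mem t hx, hW⟩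

theorem mem_sl2FiniteSubmodule_of_finite_span {S : Set X} (hS : S.Finite)
    (h : ∀ y ∈ S, ⁅SlHat.e K (1 : J), y⁆ ∈ Submodule.span K S ∧
      ⁅SlHat.h K (1 : J), y⁆ ∈ Submodule.span K S ∧ ⁅SlHat.f K (1 : J), y⁆ ∈ Submodule.span K S)
    {x : X} (hx : x ∈ S) : x ∈ sl2FiniteSubmodule K J X :=
  ⟨Submodule.span K S, FiniteDimensional.span_of_finite K hS, Submodule.subset_span hx,
    isSL2Stable_span h⟩

theorem SlHat.eq_add (y : SlHat K J) :
    y = SlHat.e K y.ePart + SlHat.h K y.hPart + SlHat.f K y.fPart + SlHat.c K J y.cPart := by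
  ext <;> simp [SlHat.e, SlHat.h, SlHat.f, SlHat.c]

variable (K J) in
/-- The adjoint module is `𝔰𝔩₂`-finite: `e(a), h(a), f(a)` span a copy of the adjoint module of
`𝔰𝔩₂`, and `{J,J}` commutes with `𝔰𝔩₂`. -/
theorem sl2FiniteSubmodule_adjoint : sl2FiniteSubmodule K J (SlHat K J) = ⊤ := by
  rw [eq_top_iff]
  intro y _
  have h1 : ∀ a : J, ∀ y ∈ ({SlHat.e K a, SlHat.h K a, SlHat.f K a} : Set (SlHat K J)),
      y ∈ sl2FiniteSubmodule K J (SlHat K J) := by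
    intro a y hy
    refine mem_sl2FiniteSubmodule_of_finite_span (by simp) (fun z hz => ?_) hy
    have he : SlHat.e K a ∈ Submodule.span K {SlHat.e K a, SlHat.h K a, SlHat.f K a} :=
      Submodule.subset_span (by simp)
    have hh : SlHat.h K a ∈ Submodule.span K {SlHat.e K a, SlHat.h K a, SlHat.f K a} :=
      Submodule.subset_span (by simp)
    have hf : SlHat.f K a ∈ Submodule.span K {SlHat.e K a, SlHat.h K a, SlHat.f K a} :=
      Submodule.subset_span (by simp)
    have hc : curly K 1 a = 0 := by rw [curly_skew, curly_one_right, neg_zero]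
    rcases hz with rfl | rfl | rfl
    · rw [SlHat.lie_e_e, SlHat.lie_h_e, ← lie_skew, SlHat.lie_e_f, curly_one_right, one_mul,
        mul_one]
      simpa using ⟨he, hh⟩
    · rw [← lie_skew, SlHat.lie_h_e, SlHat.lie_h_h, ← lie_skew (SlHat.f K 1), SlHat.lie_h_f, hc,
        mul_one]
      simpa using ⟨he, hf⟩
    · rw [SlHat.lie_f_f, SlHat.lie_h_f, SlHat.lie_e_f, hc, one_mul]
      simpa using ⟨hh, hf⟩
  have h2 : ∀ p : Curly K J, SlHat.c K J p ∈ sl2FiniteSubmodule K J (SlHat K J) := by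
    intro p
    refine mem_sl2FiniteSubmodule_of_finite_span (S := {SlHat.c K J p}) (by simp)
      (fun z hz => ?_) rfl
    have hp : curlyDer K p 1 = 0 := by
      have h := curlyDer_mul K p 1 1
      rw [mul_one, mul_one, one_mul] at h
      exact left_eq_add.1 h
    rw [Set.mem_singleton_iff.1 hz, ← lie_skew, SlHat.lie_c_e, ← lie_skew, SlHat.lie_c_h,
      ← lie_skew, SlHat.lie_c_f, hp]
    simp
  rw [SlHat.eq_add y]
  exact add_mem (add_mem (add_mem (h1 y.ePart _ (by simp)) (h1 y.hPart _ (by simp)))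
    (h1 y.fPart _ (by simp))) (h2 _)

variable (K J X) in
/-- The `𝔰𝔩₂`-finite vectors form a submodule, because the adjoint module is `𝔰𝔩₂`-finite. -/
def sl2Finite : LieSubmodule K (SlHat K J) X where
  __ := sl2FiniteSubmodule K J X
  lie_mem := by
    rintro y x ⟨W, _, hx, hW⟩
    obtain ⟨G, _, hy, hG⟩ : y ∈ sl2FiniteSubmodule K J (SlHat K J) := by
      rw [sl2FiniteSubmodule_adjoint]
      trivial
    let B : SlHat K J →ₗ[K] X →ₗ[K] X := (LieModule.toEnd K (SlHat K J) X : SlHat K J →ₗ[K] _)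
    have hB : ∀ {g m}, g ∈ G → m ∈ W → ⁅g, m⁆ ∈ Submodule.map₂ B G W := fun hg hm =>
      Submodule.apply_mem_map₂ B hg hm
    refine ⟨Submodule.map₂ B G W, ?_, hB hy hx, ?_⟩
    · exact Module.Finite.iff_fg.2
        ((Module.Finite.iff_fg.1 inferInstance).map₂ B (Module.Finite.iff_fg.1 inferInstance))
    · rw [Submodule.map₂_eq_span_image2]
      refine isSL2Stable_span ?_
      rintro _ ⟨g, hg, m, hm, rfl⟩
      rw [← Submodule.map₂_eq_span_image2]
      have hl : ∀ z : SlHat K J, ⁅z, g⁆ ∈ G → ⁅z, m⁆ ∈ W →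
          ⁅z, B g m⁆ ∈ Submodule.map₂ B G W := fun z h1 h2 => by
        change ⁅z, ⁅g, m⁆⁆ ∈ _
        rw [leibniz_lie]
        exact add_mem (hB h1 hm) (hB hg h2)
      exact ⟨hl _ (hG g hg).1 (hW m hm).1, hl _ (hG g hg).2.1 (hW m hm).2.1,
        hl _ (hG g hg).2.2 (hW m hm).2.2⟩

variable (K J X) in
theorem isSL2Module_sl2Finite : IsSL2Module K J (sl2Finite K J X) := by
  rintro ⟨x, W, hf, hx, hW⟩
  refine ⟨W.comap (sl2Finite K J X).toSubmodule.subtype, ?_, hx, fun y hy => hW y hy⟩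
  exact Module.Finite.of_injective
    (((sl2Finite K J X).toSubmodule.subtype.restrict (p := W.comap _) (q := W) fun y hy => hy))
    fun y z h => Subtype.ext (Subtype.ext (congrArg (fun w : W => (w : X)) h))

/-- `h(1)` acts on `f(1)^i x` by `n - 2i` if it acts on `x` by `n`. -/
theorem lie_h_toEnd_f_pow {x : X} {n : K} (hh : ⁅SlHat.h K (1 : J), x⁆ = n • x) (i : ℕ) :
    ⁅SlHat.h K (1 : J), (LieModule.toEnd K (SlHat K J) X (SlHat.f K 1) ^ i) x⁆ =
      (n - 2 * i) • (LieModule.toEnd K (SlHat K J) X (SlHat.f K 1) ^ i) x := by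
  induction i with
  | zero => simpa using hh
  | succ i ih =>
    rw [pow_succ', Module.End.mul_apply, LieModule.toEnd_apply_apply, leibniz_lie, ih,
      SlHat.lie_h_f, neg_lie, smul_lie, lie_smul, one_mul]
    push_cast
    module

theorem lie_e_toEnd_f_pow_succ {x : X} {n : K} (hh : ⁅SlHat.h K (1 : J), x⁆ = n • x)
    (he : ⁅SlHat.e K (1 : J), x⁆ = 0) (i : ℕ) :
    ⁅SlHat.e K (1 : J), (LieModule.toEnd K (SlHat K J) X (SlHat.f K 1) ^ (i + 1)) x⁆ =
      ((i + 1) * (n - i)) • (LieModule.toEnd K (SlHat K J) X (SlHat.f K 1) ^ i) x := by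
  have hef : ⁅SlHat.e K (1 : J), SlHat.f K (1 : J)⁆ = SlHat.h K 1 := by
    rw [SlHat.lie_e_f, curly_self, map_zero, smul_zero, add_zero, one_mul]
  induction i with
  | zero =>
    rw [zero_add, pow_one, LieModule.toEnd_apply_apply, leibniz_lie, hef, he, hh]
    simp
  | succ i ih =>
    rw [pow_succ', Module.End.mul_apply, LieModule.toEnd_apply_apply, leibniz_lie, ih, hef,
      lie_h_toEnd_f_pow hh, lie_smul, pow_succ', Module.End.mul_apply, LieModule.toEnd_apply_apply]
    push_cast
    module

/-- A highest weight vector of weight `n` is killed by `f(1)^{n+1}` in an `𝔰𝔩₂`-finite module: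
otherwise the `f(1)^i x` are nonzero eigenvectors of `h(1)` for infinitely many eigenvalues. -/
theorem toEnd_f_pow_eq_zero (hX : IsSL2Module K J X) {x : X} {n : ℕ}
    (hh : ⁅SlHat.h K (1 : J), x⁆ = (n : K) • x) (he : ⁅SlHat.e K (1 : J), x⁆ = 0) :
    (LieModule.toEnd K (SlHat K J) X (SlHat.f K 1) ^ (n + 1)) x = 0 := by
  by_contra hne
  set T := LieModule.toEnd K (SlHat K J) X (SlHat.f K 1) with hT
  obtain ⟨W, _, hxW, hW⟩ := hX x
  have hmem : ∀ i, (T ^ i) x ∈ W := by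
    intro i
    induction i with
    | zero => exact hxW
    | succ i ih =>
      rw [pow_succ', Module.End.mul_apply]
      exact (hW _ ih).2.2
  have hne' : ∀ i, (T ^ (n + 1 + i)) x ≠ 0 := by
    intro i
    induction i with
    | zero => exact hne
    | succ i ih =>
      intro h0
      have h := lie_e_toEnd_f_pow_succ hh he (n + 1 + i)
      rw [← hT, add_assoc (n + 1), h0, lie_zero, eq_comm, smul_eq_zero, or_iff_left ih,
        mul_eq_zero] at h
      rcases h with h | h
      · exact Nat.cast_add_one_ne_zero _ h
      · rw [sub_eq_zero, Nat.cast_inj] at h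
        omega
  let H : Module.End K W := (LieModule.toEnd K (SlHat K J) X (SlHat.h K 1)).restrict
    fun y hy => (hW y hy).2.1
  have hli := Module.End.eigenvectors_linearIndependent' H
    (fun i : ℕ => (n : K) - 2 * ((n + 1 + i : ℕ) : K))
    (fun i j h => by simpa using h) (fun i => ⟨(T ^ (n + 1 + i)) x, hmem _⟩) (fun i => by
      refine ⟨Module.End.mem_eigenspace_iff.2 (Subtype.ext (lie_h_toEnd_f_pow hh _)), fun h => ?_⟩
      exact hne' i (congrArg Subtype.val h))
  exact not_finite_iff_infinite.2 inferInstance hli.finite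

/-- A highest weight vector of weight `n` killed by `f(1)^{n+1}` is `𝔰𝔩₂`-finite. -/
theorem mem_sl2Finite_of_toEnd_f_pow_eq_zero {x : X} {n : ℕ}
    (hh : ⁅SlHat.h K (1 : J), x⁆ = (n : K) • x) (he : ⁅SlHat.e K (1 : J), x⁆ = 0)
    (hf : (LieModule.toEnd K (SlHat K J) X (SlHat.f K 1) ^ (n + 1)) x = 0) :
    x ∈ sl2Finite K J X := by
  set T := LieModule.toEnd K (SlHat K J) X (SlHat.f K 1) with hT
  let S : Set X := (fun i => (T ^ i) x) '' Set.Iio (n + 1)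
  have hS : ∀ i < n + 1, (T ^ i) x ∈ Submodule.span K S := fun i hi =>
    Submodule.subset_span ⟨i, hi, rfl⟩
  refine mem_sl2FiniteSubmodule_of_finite_span (S := S) ((Set.finite_Iio _).image _) ?_
    ⟨0, n.succ_pos, rfl⟩
  rintro _ ⟨i, hi, rfl⟩
  refine ⟨?_, ?_, ?_⟩
  · match i with
    | 0 => simp [he]
    | i + 1 =>
      simp only
      rw [lie_e_toEnd_f_pow_succ hh he]
      exact Submodule.smul_mem _ _ (hS i (Nat.lt_of_succ_lt hi))
  · simp only
    rw [lie_h_toEnd_f_pow hh]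
    exact Submodule.smul_mem _ _ (hS i hi)
  · change T ((T ^ i) x) ∈ _
    rw [← Module.End.mul_apply, ← pow_succ']
    rcases Nat.lt_or_ge (i + 1) (n + 1) with h | h
    · exact hS _ h
    · rw [show i + 1 = n + 1 from le_antisymm hi h, hf]
      exact zero_mem _

end LocallyFinite

/-! ### Linear maps on the symmetric algebra -/

section SymmetricFunctions

variable (K : Type u) (J : Type v) (V : Type w) [Field K] [AddCommGroup J] [Module K J]
  [AddCommGroup V] [Module K V]

/-- Linear maps from the symmetric algebra of `J` to `V`, encoded as functions on lists
(`F [x₁, …, x_k]` is the value at the monomial `x₁ ⋯ x_k`) which are invariant under permutations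
and linear in the head, hence in every entry. -/
def symFun : Submodule K (List J → V) where
  carrier := {F | (∀ l l' : List J, l.Perm l' → F l = F l') ∧
    (∀ x y l, F ((x + y) :: l) = F (x :: l) + F (y :: l)) ∧
    ∀ (t : K) x l, F ((t • x) :: l) = t • F (x :: l)}
  zero_mem' := by simp
  add_mem' := by
    rintro F G ⟨h1, h2, h3⟩ ⟨h1', h2', h3'⟩
    refine ⟨fun l l' h => ?_, fun x y l => ?_, fun t x l => ?_⟩
    · simp only [Pi.add_apply, h1 l l' h, h1' l l' h]
    · simp only [Pi.add_apply, h2, h2']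
      abel
    · simp only [Pi.add_apply, h3, h3', smul_add]
  smul_mem' := by
    rintro t F ⟨h1, h2, h3⟩
    refine ⟨fun l l' h => ?_, fun x y l => ?_, fun s x l => ?_⟩
    · simp only [Pi.smul_apply, h1 l l' h]
    · simp only [Pi.smul_apply, h2, smul_add]
    · simp only [Pi.smul_apply, h3, smul_comm t s]

variable {K J V}

namespace symFun

instance : CoeFun (symFun K J V) fun _ => List J → V := ⟨fun F => F.1⟩

theorem ext {F G : symFun K J V} (h : ∀ l, F l = G l) : F = G := Subtype.ext (funext h)

theorem perm (F : symFun K J V) {l l' : List J} (h : l.Perm l') : F l = F l' := F.2.1 l l' h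

/-- Multiplication by `x ∈ J`, transposed: `F ↦ F(x ·)`. -/
def shift : J →ₗ[K] symFun K J V →ₗ[K] symFun K J V :=
  LinearMap.mk₂ K
    (fun x F => ⟨fun l => F (x :: l), fun _ _ h => symFun.perm F (h.cons x),
      fun y z l => by
        beta_reduce
        rw [symFun.perm F (List.Perm.swap (y + z) x l), F.2.2.1, symFun.perm F (List.Perm.swap y x l),
          symFun.perm F (List.Perm.swap z x l)],
      fun t y l => by
        beta_reduce
        rw [symFun.perm F (List.Perm.swap (t • y) x l), F.2.2.2, symFun.perm F (List.Perm.swap y x l)]⟩)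
    (fun x y F => ext fun l => F.2.2.1 x y l) (fun t x F => ext fun l => F.2.2.2 t x l)
    (fun _ _ _ => rfl) (fun _ _ _ => rfl)

theorem shift_apply (x : J) (F : symFun K J V) (l : List J) : shift x F l = F (x :: l) := rfl

theorem shift_comm (x y : J) (F : symFun K J V) : shift x (shift y F) = shift y (shift x F) :=
  ext fun l => symFun.perm F (List.Perm.swap x y l)

end symFun

end SymmetricFunctions

/-! ### The coinduced action -/

section Coinduced

variable {K : Type u} {J : Type v} {V : Type w} [Field K] [CharZero K]
  [NonAssocCommRing J] [IsCommJordan J] [Module K J] [IsScalarTower K J J] [SMulCommClass K J J]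
  [AddCommGroup V] [Module K V] {ρ : J →ₗ[K] Module.End K V} (hρ : IsJSpace ρ)

/-- The `J`-space `V` as a representation of `(h ⊗ J) ⊕ {J,J}`, extended by zero to
`(e ⊗ J) ⊕ (f ⊗ J)`. -/
def levelRep : SlHat K J →ₗ[K] Module.End K V where
  toFun y := ρ y.hPart + (4⁻¹ : K) • curlyRho hρ y.cPart
  map_add' y z := by simp only [SlHat.add_hPart, SlHat.add_cPart, map_add, smul_add]; abel
  map_smul' t y := by
    simp only [SlHat.smul_hPart, SlHat.smul_cPart, map_smul, smul_add, RingHom.id_apply,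
      smul_comm t]

theorem levelRep_apply (y : SlHat K J) :
    levelRep hρ y = ρ y.hPart + (4⁻¹ : K) • curlyRho hρ y.cPart := rfl

theorem SlHat.sub_ePart (y z : SlHat K J) : (y - z).ePart = y.ePart - z.ePart := by
  rw [sub_eq_add_neg, SlHat.add_ePart, SlHat.neg_ePart, sub_eq_add_neg]

theorem curlyRho_lie_rho (p : Curly K J) (a : J) :
    curlyRho hρ p * ρ a - ρ a * curlyRho hρ p = (4 : K) • ρ (curlyDer K p a) := by
  induction p using curly_induction with
  | h0 => simp
  | h1 b c => rw [curlyRho_curly, curlyDer_curly, ← hρ.lie_lie]; rfl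
  | h2 p q hp hq =>
    simp only [map_add, LinearMap.add_apply, smul_add, ← hp, ← hq, add_mul, mul_add]
    abel

theorem curlyRho_lie_curlyRho (p q : Curly K J) :
    curlyRho hρ p * curlyRho hρ q - curlyRho hρ q * curlyRho hρ p =
      (4 : K) • curlyRho hρ (curlyAct K p q) := by
  induction q using curly_induction with
  | h0 => simp
  | h1 b c =>
    have hb := curlyRho_lie_rho hρ p b
    have hc := curlyRho_lie_rho hρ p c
    rw [curlyAct_curly, map_add, curlyRho_curly, curlyRho_curly, curlyRho_curly, smul_add,
      Ring.lie_def, Ring.lie_def, Ring.lie_def, smul_sub, smul_sub, ← smul_mul_assoc,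
      ← mul_smul_comm, ← mul_smul_comm, ← smul_mul_assoc, ← hb, ← hc]
    noncomm_ring
  | h2 q r hq hr =>
    simp only [map_add, smul_add, ← hq, ← hr, add_mul, mul_add]
    abel

/-- `levelRep` is a representation of the parabolic subalgebra of elements without `e`-part. -/
theorem levelRep_lie {y z : SlHat K J} (hy : y.ePart = 0) (hz : z.ePart = 0) :
    levelRep hρ ⁅y, z⁆ = levelRep hρ y * levelRep hρ z - levelRep hρ z * levelRep hρ y := by
  have h1 := curlyRho_lie_rho hρ y.cPart z.hPart
  have h2 := curlyRho_lie_rho hρ z.cPart y.hPart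
  have h3 := curlyRho_lie_curlyRho hρ y.cPart z.cPart
  simp only [levelRep_apply, SlHat.lie_hPart, SlHat.lie_cPart, hy, hz, zero_mul, mul_zero,
    curly_zero_left, curly_zero_right, smul_zero, map_add, map_sub, map_smul, curlyRho_curly,
    Ring.lie_def, map_zero, add_mul, mul_add, smul_mul_assoc, mul_smul_comm]
  linear_combination (norm := module) (-4⁻¹ : K) • h1 + (4⁻¹ : K) • h2 - (16⁻¹ : K) • h3

/-- The action of `𝔰𝔩₂^(J)` on the coinduced module. The value `F [x₁, …, x_k]` stands for the
component in `V` of `e(x_k) ⋯ e(x₁) F`; the recursion moves `y` to the left through the `e(x)`, and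
on the empty list `y` is split into its `e`-part and its part in the parabolic subalgebra. -/
def coindAct : List J → SlHat K J → symFun K J V → V
  | [], y, F => F [y.ePart] + levelRep hρ y (F [])
  | x :: l, y, F => coindAct l y (symFun.shift x F) + coindAct l ⁅SlHat.e K x, y⁆ F

theorem coindAct_nil (y : SlHat K J) (F : symFun K J V) :
    coindAct hρ [] y F = F [y.ePart] + levelRep hρ y (F []) := rfl

theorem coindAct_cons (x : J) (l : List J) (y : SlHat K J) (F : symFun K J V) :
    coindAct hρ (x :: l) y F =
      coindAct hρ l y (symFun.shift x F) + coindAct hρ l ⁅SlHat.e K x, y⁆ F := rfl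

theorem coindAct_add_left (l : List J) (y z : SlHat K J) (F : symFun K J V) :
    coindAct hρ l (y + z) F = coindAct hρ l y F + coindAct hρ l z F := by
  induction l generalizing y z F with
  | nil =>
    simp only [coindAct_nil, SlHat.add_ePart, F.2.2.1, map_add, LinearMap.add_apply]
    abel
  | cons x l ih =>
    simp only [coindAct_cons, lie_add, ih]
    abel

theorem coindAct_smul_left (l : List J) (t : K) (y : SlHat K J) (F : symFun K J V) :
    coindAct hρ l (t • y) F = t • coindAct hρ l y F := by
  induction l generalizing y F with
  | nil => simp only [coindAct_nil, SlHat.smul_ePart, F.2.2.2, map_smul, LinearMap.smul_apply,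
      smul_add]
  | cons x l ih => simp only [coindAct_cons, lie_smul, ih, smul_add]

theorem coindAct_add_right (l : List J) (y : SlHat K J) (F G : symFun K J V) :
    coindAct hρ l y (F + G) = coindAct hρ l y F + coindAct hρ l y G := by
  induction l generalizing y F G with
  | nil =>
    simp only [coindAct_nil, Submodule.coe_add, Pi.add_apply, map_add]
    abel
  | cons x l ih =>
    simp only [coindAct_cons, map_add, ih]
    abel

theorem coindAct_smul_right (l : List J) (t : K) (y : SlHat K J) (F : symFun K J V) :
    coindAct hρ l y (t • F) = t • coindAct hρ l y F := by
  induction l generalizing y F with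
  | nil => simp only [coindAct_nil, Submodule.coe_smul, Pi.smul_apply, map_smul, smul_add]
  | cons x l ih => simp only [coindAct_cons, map_smul, ih, smul_add]

/-- The action preserves symmetric functions because `e ⊗ J` is abelian. -/
theorem coindAct_perm {l l' : List J} (h : l.Perm l') (y : SlHat K J) (F : symFun K J V) :
    coindAct hρ l y F = coindAct hρ l' y F := by
  induction h generalizing y F with
  | nil => rfl
  | cons x _ ih => simp only [coindAct_cons, ih]
  | swap x z l =>
    have h : ⁅SlHat.e K x, ⁅SlHat.e K z, y⁆⁆ = ⁅SlHat.e K z, ⁅SlHat.e K x, y⁆⁆ := by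
      rw [leibniz_lie, SlHat.lie_e_e, zero_lie, zero_add]
    simp only [coindAct_cons, h, symFun.shift_comm x z]
    abel
  | trans _ _ ih ih' => rw [ih, ih']

/-- The action of an element of `𝔰𝔩₂^(J)` on the coinduced module. -/
def coindMap (y : SlHat K J) (F : symFun K J V) : symFun K J V :=
  ⟨fun l => coindAct hρ l y F, fun _ _ h => coindAct_perm hρ h y F,
    fun x z l => by
      simp only [coindAct_cons, map_add, LinearMap.add_apply, coindAct_add_right, add_lie,
        coindAct_add_left]
      abel,
    fun t x l => by
      simp only [coindAct_cons, map_smul, LinearMap.smul_apply, coindAct_smul_right, smul_lie,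
        coindAct_smul_left, smul_add]⟩

theorem coindMap_apply (y : SlHat K J) (F : symFun K J V) (l : List J) :
    coindMap hρ y F l = coindAct hρ l y F := rfl

theorem shift_coindMap (x : J) (y : SlHat K J) (F : symFun K J V) :
    symFun.shift x (coindMap hρ y F) =
      coindMap hρ y (symFun.shift x F) + coindMap hρ ⁅SlHat.e K x, y⁆ F := rfl

/-- The recursive action is a Lie algebra action: the inductive step is the Jacobi identity, and the
empty list is the only place where the representation on `V` enters. -/
theorem coindAct_lie (l : List J) (y z : SlHat K J) (F : symFun K J V) :
    coindAct hρ l ⁅y, z⁆ F =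
      coindAct hρ l y (coindMap hρ z F) - coindAct hρ l z (coindMap hρ y F) := by
  induction l generalizing y z F with
  | cons x l ih =>
    simp only [coindAct_cons, shift_coindMap, coindAct_add_right, ih, leibniz_lie (SlHat.e K x) y z,
      coindAct_add_left]
    abel
  | nil =>
    -- `y = e(a) + p` and `z = e(b) + q` with `p`, `q` in the parabolic subalgebra
    have hsplit : ∀ y : SlHat K J, ∃ p : SlHat K J, p.ePart = 0 ∧ y = SlHat.e K y.ePart + p :=
      fun y => ⟨⟨0, y.hPart, y.fPart, y.cPart⟩, rfl, by ext <;> simp [SlHat.e]⟩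
    have hlev : ∀ a, levelRep hρ (SlHat.e K a) = 0 := fun a => by
      simp [levelRep_apply, SlHat.e]
    obtain ⟨p, hp, hy⟩ := hsplit y
    obtain ⟨q, hq, hz⟩ := hsplit z
    have hlie : ⁅y, z⁆ = ⁅SlHat.e K y.ePart, z⁆ - ⁅SlHat.e K z.ePart, y⁆ + ⁅p, q⁆ := by
      have h : ∀ a b : J, ⁅SlHat.e K a + p, SlHat.e K b + q⁆ = ⁅SlHat.e K a, SlHat.e K b + q⁆
          - ⁅SlHat.e K b, SlHat.e K a + p⁆ + ⁅p, q⁆ := fun a b => by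
        simp only [add_lie, lie_add, SlHat.lie_e_e]
        rw [← lie_skew p (SlHat.e K b)]
        abel
      have h' := h y.ePart z.ePart
      rwa [← hy, ← hz] at h'
    have hpq : (⁅p, q⁆ : SlHat K J).ePart = 0 := by simp [SlHat.lie_ePart, hp, hq]
    have hyp : levelRep hρ y = levelRep hρ p := by conv_lhs => rw [hy, map_add, hlev, zero_add]
    have hzq : levelRep hρ z = levelRep hρ q := by conv_lhs => rw [hz, map_add, hlev, zero_add]
    have hswap := symFun.perm F (List.Perm.swap y.ePart z.ePart [])
    have h0 : ∀ a b : J, F [a - b] = F [a] - F [b] := fun a b => by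
      have h := map_sub (symFun.shift (K := K) (J := J) (V := V)) a b
      exact congrFun (congrArg Subtype.val (DFunLike.congr_fun h F)) []
    rw [hlie]
    simp only [coindAct_nil, coindMap_apply, coindAct_cons, symFun.shift_apply, SlHat.add_ePart,
      SlHat.sub_ePart, hpq, add_zero, h0, map_add, map_sub, LinearMap.add_apply,
      LinearMap.sub_apply, levelRep_lie hρ hp hq, Module.End.mul_apply, hyp, hzq, hswap]
    abel

end Coinduced

/-! ### Polarization -/

section Polarization

variable {K : Type u} {J : Type v} {V : Type w} [Field K] [CharZero K] [AddCommGroup J] [Module K J]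
  [AddCommGroup V] [Module K V]

theorem eq_zero_of_forall_sum_pow_smul_eq_zero {N : ℕ} {c : ℕ → V}
    (h : ∀ t : K, ∑ i ∈ Finset.range N, t ^ i • c i = 0) {i : ℕ} (hi : i < N) : c i = 0 := by
  refine (Module.forall_dual_apply_eq_zero_iff K _).1 fun φ => ?_
  have hp : ∑ i ∈ Finset.range N, Polynomial.C (φ (c i)) * Polynomial.X ^ i = 0 := by
    refine Polynomial.funext fun t => ?_
    have ht := congrArg φ (h t)
    simp only [map_sum, map_smul, smul_eq_mul, map_zero] at ht
    simp only [Polynomial.eval_finsetSum, Polynomial.eval_mul, Polynomial.eval_C,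
      Polynomial.eval_pow, Polynomial.eval_X, Polynomial.eval_zero]
    rw [← ht]
    exact Finset.sum_congr rfl fun _ _ => mul_comm _ _
  have hc := congrArg (fun p => Polynomial.coeff p i) hp
  simpa [Polynomial.finsetSum_coeff, Polynomial.coeff_C_mul, Polynomial.coeff_X_pow, hi] using hc

theorem symFun.shift_pow_apply (a : J) (N : ℕ) (F : symFun K J V) (l : List J) :
    ((symFun.shift a : Module.End K (symFun K J V)) ^ N) F l = F (List.replicate N a ++ l) := by
  induction N generalizing F with
  | zero => rfl
  | succ N ih => rw [pow_succ, Module.End.mul_apply, ih]; rfl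

/-- Polarization: a homogeneous component is determined by its values on powers. -/
theorem symFun.eq_zero_of_replicate (k : ℕ) {F : symFun K J V}
    (h : ∀ a : J, F (List.replicate k a) = 0) {l : List J} (hl : l.length = k) : F l = 0 := by
  induction k generalizing F l with
  | zero =>
    rw [List.length_eq_zero_iff.1 hl]
    exact h 0
  | succ k ih =>
    match l, hl with
    | b :: l, hl =>
      refine ih (F := symFun.shift b F) (fun a => ?_) (Nat.succ.inj hl)
      -- `F (b a^k)` is, up to the factor `k + 1`, the coefficient of `t` in `F ((t b + a)^(k+1))`
      let A : Module.End K (symFun K J V) := symFun.shift a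
      let B : Module.End K (symFun K J V) := symFun.shift b
      have hAB : Commute B A := LinearMap.ext fun G => symFun.shift_comm b a G
      have hsum : ∀ t : K, ∑ i ∈ Finset.range (k + 1 + 1),
          t ^ i • ((k + 1).choose i • ((B ^ i * A ^ (k + 1 - i)) F) []) = 0 := by
        intro t
        have h1 := h (t • b + a)
        have h2 := symFun.shift_pow_apply (t • b + a) (k + 1) F []
        have h3 : (symFun.shift (t • b + a) : Module.End K (symFun K J V)) = t • B + A := by
          rw [map_add, map_smul]
        rw [List.append_nil, h1, h3, (hAB.smul_left t).add_pow, LinearMap.sum_apply] at h2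
        rw [← h2, AddSubmonoidClass.coe_finsetSum, Finset.sum_apply]
        refine Finset.sum_congr rfl fun i _ => ?_
        rw [smul_pow, smul_mul_assoc, smul_mul_assoc, ← nsmul_eq_mul', LinearMap.smul_apply,
          LinearMap.smul_apply]
        rfl
      have h1 := eq_zero_of_forall_sum_pow_smul_eq_zero hsum (i := 1) (by omega)
      rw [Nat.choose_one_right, pow_one, Nat.add_sub_cancel, Module.End.mul_apply,
        ← Nat.cast_smul_eq_nsmul K, smul_eq_zero,
        or_iff_right (Nat.cast_ne_zero.2 k.succ_ne_zero)] at h1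
      have h2 := symFun.shift_pow_apply a k F [b]
      rw [symFun.shift_apply, ← List.singleton_append, symFun.perm F List.perm_append_comm, ← h2]
      exact h1

end Polarization

/-! ### The coinduced module of a `J`-space -/

section CoinducedModule

variable {K : Type u} {J : Type v} {V : Type w} [Field K] [CharZero K]
  [NonAssocCommRing J] [IsCommJordan J] [Module K J] [IsScalarTower K J J] [SMulCommClass K J J]
  [AddCommGroup V] [Module K V] {ρ : J →ₗ[K] Module.End K V}

/-- The module coinduced from the `J`-space `V`, on which the parabolic subalgebra
`(h ⊗ J) ⊕ (f ⊗ J) ⊕ {J,J}` acts through its quotient by `f ⊗ J`. Its underlying space is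
`Hom (Sym J, V)`. -/
def Coind (_ : IsJSpace ρ) : Type (max v w) := symFun K J V

variable (hρ : IsJSpace ρ)

instance : AddCommGroup (Coind hρ) := inferInstanceAs (AddCommGroup (symFun K J V))

instance : Module K (Coind hρ) := inferInstanceAs (Module K (symFun K J V))

instance : LieRingModule (SlHat K J) (Coind hρ) where
  bracket := coindMap hρ
  add_lie y z F := symFun.ext fun l => coindAct_add_left hρ l y z F
  lie_add y F G := symFun.ext fun l => coindAct_add_right hρ l y F G
  leibniz_lie y z F := symFun.ext fun l => by
    have h := coindAct_lie hρ l y z F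
    exact (sub_eq_iff_eq_add.1 h.symm)

instance : LieModule K (SlHat K J) (Coind hρ) where
  smul_lie t y F := symFun.ext fun l => coindAct_smul_left hρ l t y F
  lie_smul t y F := symFun.ext fun l => coindAct_smul_right hρ l t y F

namespace Coind

variable {hρ}

/-- The value of an element of the coinduced module at a monomial. -/
def val (F : Coind hρ) (l : List J) : V := F.1 l

theorem ext {F G : Coind hρ} (h : ∀ l, F.val l = G.val l) : F = G := symFun.ext h

theorem val_smul (t : K) (F : Coind hρ) (l : List J) : (t • F).val l = t • F.val l := rfl

theorem val_zero (l : List J) : (0 : Coind hρ).val l = 0 := rfl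

/-- Multiplication by `x ∈ J`, transposed. -/
def shift (x : J) (F : Coind hρ) : Coind hρ := symFun.shift x F

theorem val_shift (x : J) (F : Coind hρ) (l : List J) : (shift x F).val l = F.val (x :: l) := rfl

theorem val_lie_nil (y : SlHat K J) (F : Coind hρ) :
    ⁅y, F⁆.val [] = F.val [y.ePart] + levelRep hρ y (F.val []) := rfl

theorem val_lie_cons (y : SlHat K J) (F : Coind hρ) (x : J) (l : List J) :
    ⁅y, F⁆.val (x :: l) = ⁅y, shift x F⁆.val l + ⁅⁅SlHat.e K x, y⁆, F⁆.val l := rfl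

theorem val_zero_cons (F : Coind hρ) (l : List J) : F.val (0 :: l) = 0 := by
  have h := F.2.2.2 0 0 l
  rw [zero_smul, zero_smul] at h
  exact h

theorem val_lie_e (b : J) (F : Coind hρ) (l : List J) : ⁅SlHat.e K b, F⁆.val l = F.val (b :: l) := by
  induction l generalizing F with
  | nil =>
    have h : levelRep hρ (SlHat.e K b) = 0 := by simp [levelRep_apply, SlHat.e]
    rw [val_lie_nil, h, LinearMap.zero_apply, add_zero]
    rfl
  | cons x l ih =>
    rw [val_lie_cons, ih, SlHat.lie_e_e, zero_lie, val_zero, add_zero, val_shift]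
    exact symFun.perm F (List.Perm.swap b x l)

theorem lie_e_h (x a : J) : ⁅SlHat.e K x, SlHat.h K a⁆ = (-2 : K) • SlHat.e K (a * x) := by
  rw [← lie_skew, SlHat.lie_h_e, neg_smul]

theorem levelRep_h (a : J) : levelRep hρ (SlHat.h K a) = ρ a := by
  simp [levelRep_apply, SlHat.h]

theorem val_toEnd_e_pow (b : J) (N : ℕ) (F : Coind hρ) :
    ((LieModule.toEnd K (SlHat K J) (Coind hρ) (SlHat.e K b) ^ N) F).val [] =
      F.val (List.replicate N b) := by
  have h : ∀ l, ((LieModule.toEnd K (SlHat K J) (Coind hρ) (SlHat.e K b) ^ N) F).val l =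
      F.val (List.replicate N b ++ l) := by
    induction N with
    | zero => exact fun _ => rfl
    | succ N ih =>
      intro l
      rw [pow_succ', Module.End.mul_apply, LieModule.toEnd_apply_apply, val_lie_e, ih,
        List.replicate_succ', List.append_assoc, List.singleton_append]
  rw [h, List.append_nil]

/-- On a `J`-space of level `n`, the homogeneous functions of degree `k` have weight `n - 2k`. -/
theorem val_lie_h_one {n : ℕ} (hn : ρ 1 = (n : K) • LinearMap.id) (F : Coind hρ) (l : List J) :
    ⁅SlHat.h K (1 : J), F⁆.val l = ((n : K) - 2 * l.length) • F.val l := by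
  induction l generalizing F with
  | nil =>
    change F.val [0] + levelRep hρ (SlHat.h K 1) (F.val []) = _
    rw [val_zero_cons, levelRep_h, hn]
    simp
  | cons x l ih =>
    rw [val_lie_cons, ih, val_shift, lie_e_h, smul_lie, val_smul, val_lie_e, one_mul,
      List.length_cons]
    push_cast
    module

variable (hρ) in
/-- The embedding of `V` as the functions concentrated in degree zero. -/
def const : V →ₗ[K] Coind hρ where
  toFun v := ⟨fun l => match l with
    | [] => v
    | _ :: _ => 0, fun l l' h => by
      cases l <;> cases l'
      · rfl
      · exact absurd h.length_eq (by simp)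
      · exact absurd h.length_eq (by simp)
      · rfl, by simp, by simp⟩
  map_add' v v' := ext fun l => by
    cases l
    · rfl
    · exact (add_zero _).symm
  map_smul' t v := ext fun l => by
    cases l
    · rfl
    · exact (smul_zero t).symm

theorem val_const_cons (v : V) (x : J) (l : List J) : (const hρ v).val (x :: l) = 0 := rfl

theorem lie_e_const (b : J) (v : V) : ⁅SlHat.e K b, const hρ v⁆ = 0 :=
  ext fun l => by rw [val_lie_e, val_const_cons]; rfl

theorem lie_h_const (a : J) (v : V) : ⁅SlHat.h K a, const hρ v⁆ = const hρ (ρ a v) := by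
  refine ext fun l => ?_
  cases l with
  | nil =>
    change (const hρ v).val [0] + levelRep hρ (SlHat.h K a) ((const hρ v).val []) = _
    rw [val_zero_cons, levelRep_h, zero_add]
    rfl
  | cons x l =>
    have h0 : shift x (const hρ v) = 0 := rfl
    rw [val_lie_cons, h0, lie_zero, val_zero, lie_e_h, smul_lie, val_smul, val_lie_e,
      val_const_cons, val_const_cons, smul_zero, add_zero]

/-- The function `f(1)^{n+1} v` is homogeneous of degree `n + 1`, and on powers it is computed by
Garland's formula. -/
theorem toEnd_f_pow_const_eq_zero {n : ℕ} (hn : ρ 1 = (n : K) • LinearMap.id)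
    (hP : ∀ a : J, esymmRho ρ a (n + 1) = 0) (v : V) :
    (LieModule.toEnd K (SlHat K J) (Coind hρ) (SlHat.f K 1) ^ (n + 1)) (const hρ v) = 0 := by
  set G := (LieModule.toEnd K (SlHat K J) (Coind hρ) (SlHat.f K 1) ^ (n + 1)) (const hρ v) with hG
  have hrep : ∀ a : J, G.val (List.replicate (n + 1) a) = 0 := by
    intro a
    have h := esymmRho_intertwine (ρ := ρ) (ρ' := hRho K J (Coind hρ)) (const hρ)
      (fun a x => (lie_h_const a x).symm) a (n + 1) v
    rw [← val_toEnd_e_pow, hG, toEnd_e_pow_toEnd_f_pow a (n + 1) fun b => lie_e_const b v, ← h, hP,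
      LinearMap.zero_apply, map_zero, smul_zero]
    rfl
  refine ext fun l => ?_
  by_cases hl : l.length = n + 1
  · exact symFun.eq_zero_of_replicate (n + 1) hrep hl
  · have h1 := val_lie_h_one hn G l
    rw [hG, lie_h_toEnd_f_pow (n := (n : K)) (by rw [lie_h_const, hn]; simp), ← hG, val_smul,
      ← sub_eq_zero, ← sub_smul, smul_eq_zero] at h1
    refine h1.resolve_left fun h0 => hl ?_
    have h2 : (2 : K) * ((l.length : K) - ((n + 1 : ℕ) : K)) = 0 := by linear_combination h0
    rw [mul_eq_zero, or_iff_right two_ne_zero, sub_eq_zero] at h2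
    exact_mod_cast h2

end Coind

end CoinducedModule

/-! ### The dominance criterion -/

section DominanceCriterion

variable {K : Type u} {J : Type v} {V : Type w} [Field K] [CharZero K]
  [NonAssocCommRing J] [IsCommJordan J] [Module K J] [IsScalarTower K J J] [SMulCommClass K J J]
  [AddCommGroup V] [Module K V] {ρ : J →ₗ[K] Module.End K V}

/-- Dominance may be tested on modules in the universe of the coinduced module. -/
theorem isDominant_of_injective {X : Type (max v w)} [AddCommGroup X] [Module K X]
    [LieRingModule (SlHat K J) X] [LieModule K (SlHat K J) X] (hX : IsSL2Module K J X)
    (ψ : V →ₗ[K] X) (hψ : Function.Injective ψ) (he : ∀ (b : J) v, ⁅SlHat.e K b, ψ v⁆ = 0)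
    (hh : ∀ a v, ψ (ρ a v) = ⁅SlHat.h K a, ψ v⁆) : IsDominant ρ := by
  let i : X ≃ₗ[K] ULift.{u} X := ULift.moduleEquiv.symm
  let _ : LieRingModule (SlHat K J) (ULift.{u} X) :=
    { bracket := fun y x => i ⁅y, x.down⁆
      add_lie := fun y z x => congrArg i (add_lie y z x.down)
      lie_add := fun y x x' => congrArg i (lie_add y x.down x'.down)
      leibniz_lie := fun y z x => congrArg i (leibniz_lie y z x.down) }
  let _ : LieModule K (SlHat K J) (ULift.{u} X) :=
    { smul_lie := fun t y x => congrArg i (smul_lie t y x.down)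
      lie_smul := fun t y x => congrArg i (lie_smul t y x.down) }
  refine ⟨ULift.{u} X, inferInstance, inferInstance, inferInstance, inferInstance, ?_, ?_⟩
  · rintro ⟨x⟩
    obtain ⟨W, hf, hx, hW⟩ := hX x
    refine ⟨W.map (i : X →ₗ[K] ULift.{u} X), inferInstance, ⟨x, hx, rfl⟩, ?_⟩
    rintro _ ⟨y, hy, rfl⟩
    exact ⟨⟨_, (hW y hy).1, rfl⟩, ⟨_, (hW y hy).2.1, rfl⟩, ⟨_, (hW y hy).2.2, rfl⟩⟩
  · refine ⟨LinearMap.codRestrict (H0 K J (ULift.{u} X))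
      ((i : X →ₗ[K] ULift.{u} X) ∘ₗ ψ) fun v b => congrArg i (he b v), ?_, ?_⟩
    · intro v v' h
      exact hψ (i.injective (congrArg Subtype.val h))
    · intro a v
      exact Subtype.ext (congrArg i (hh a v))

theorem IsDominant.esymmRho_eq_zero {n : ℕ} (hn : ρ 1 = (n : K) • LinearMap.id)
    (h : IsDominant ρ) (a : J) : esymmRho ρ a (n + 1) = 0 := by
  obtain ⟨X, _, _, _, _, hX, φ, hφ, hh⟩ := h
  let ψ : V →ₗ[K] X := (H0 K J X).subtype ∘ₗ φ
  have hψ : ∀ a x, ψ (ρ a x) = hRho K J X a (ψ x) := fun a x => congrArg Subtype.val (hh a x)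
  have hfact : ((n + 1).factorial : K) ≠ 0 := Nat.cast_ne_zero.2 (Nat.factorial_ne_zero _)
  ext v
  have hweight : ⁅SlHat.h K (1 : J), ψ v⁆ = (n : K) • ψ v := by
    rw [← hRho_apply, ← hψ, hn, LinearMap.smul_apply, LinearMap.id_apply, map_smul]
  have hf := toEnd_f_pow_eq_zero hX hweight ((φ v).2 1)
  have hG := toEnd_e_pow_toEnd_f_pow a (n + 1) (φ v).2
  have hv : ((φ v : H0 K J X) : X) = ψ v := rfl
  rw [hv, hf, map_zero, ← esymmRho_intertwine ψ hψ, eq_comm, smul_eq_zero,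
    or_iff_right (mul_ne_zero hfact hfact)] at hG
  rw [LinearMap.zero_apply]
  exact hφ (Subtype.ext (hG.trans (by rw [map_zero]; rfl)))

theorem isDominant_of_esymmRho_eq_zero (hρ : IsJSpace ρ) {n : ℕ}
    (hn : ρ 1 = (n : K) • LinearMap.id) (hP : ∀ a : J, esymmRho ρ a (n + 1) = 0) :
    IsDominant ρ := by
  have hmem : ∀ v, Coind.const hρ v ∈ sl2Finite K J (Coind hρ) := fun v =>
    mem_sl2Finite_of_toEnd_f_pow_eq_zero (n := n) (by rw [Coind.lie_h_const, hn]; simp)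
      (Coind.lie_e_const 1 v) (Coind.toEnd_f_pow_const_eq_zero hn hP v)
  refine isDominant_of_injective (isSL2Module_sl2Finite K J (Coind hρ))
    ((Coind.const hρ).codRestrict (sl2Finite K J (Coind hρ)).toSubmodule hmem) ?_ ?_ ?_
  · intro v v' h
    exact congrArg (fun F : sl2Finite K J (Coind hρ) => F.1.val []) h
  · exact fun b v => Subtype.ext (Coind.lie_e_const b v)
  · exact fun a v => Subtype.ext (Coind.lie_h_const a v).symm

end DominanceCriterion

end TitsAllisonGao

theorem theorem1 {K : Type*} {J : Type*} {V : Type*} [Field K] [CharZero K]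
    [NonAssocCommRing J] [IsCommJordan J] [Module K J] [IsScalarTower K J J] [SMulCommClass K J J]
    [AddCommGroup V] [Module K V]
    (ρ : J →ₗ[K] Module.End K V) (hρ : TitsAllisonGao.IsJSpace ρ)
    (n : ℕ) (hn : ρ 1 = (n : K) • LinearMap.id) :
    TitsAllisonGao.IsDominant ρ ↔
      ∀ a : J, ∑ σ : (n + 1).Partition,
        (TitsAllisonGao.partitionSign σ * (TitsAllisonGao.cycleClassCard σ : ℤ)) •
          TitsAllisonGao.rhoPartition ρ σ a = 0 := by
  have hfact : ((n + 1).factorial : K) ≠ 0 := Nat.cast_ne_zero.2 (Nat.factorial_ne_zero _)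
  simp only [TitsAllisonGao.sum_partition_eq, smul_eq_zero, hfact, false_or]
  exact ⟨fun h => h.esymmRho_eq_zero hn, TitsAllisonGao.isDominant_of_esymmRho_eq_zero hρ hn⟩
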